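/- Let $\Phi$ be a finite irreducible reduced crystallographic root system (any type $A,B,C,D,E,F,G$) with simple roots $\alpha_i$ $(i\in\triangle_0)$, positive roots $\Phi^+$, negative roots $\Phi^-=-\Phi^+$, fundamental weights $\varpi_i$, simple reflections $s_i$, Weyl group $W$ and longest element $w_0\in W$. Let $i\mapsto i^*$ be the involution of $\triangle_0$ with $w_0\alpha_i=-\alpha_{i^*}$, and let $\mathsf h=2|\Phi^+|/|\triangle_0|$ be the Coxeter number. A Dynkin quiver $Q=(\triangle,\xi)$ is the Dynkin diagram $\triangle$ with a height function $\xi:\triangle_0\to\mathbb Z$ such that $|\xi_i-\xi_j|=1$ for adjacent $i,j$. A vertex $i$ is a source of $Q$ if $\xi_i>\xi_j$ for all $j$ adjacent to $i$; then $s_iQ=(\triangle,s_i\xi)$ with $(s_i\xi)_j=\xi_j-2\delta_{ij}$. Let $\tau_Q=s_{i_1}\cdots s_{i_n}$ be the unique Coxeter element with an expression in which each vertex occurs exactly once and $i_k$ is a source of $s_{i_{k-1}}\cdots s_{i_1}Q$ for all $k$, and put $\gamma_i^Q=(1-\tau_Q)\varpi_i$. Let $\widehat\triangle_0=\{(i,p)\in\triangle_0\times\mathbb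 Z : p-\xi_i\in2\mathbb Z\}$, and define $\phi_Q:\widehat\triangle_0\to\Phi^+\times\mathbb Z$ inductively by $\phi_Q(i,\xi_i)=(\gamma_i^Q,0)$ and, if $\phi_Q(i,p)=(\beta,u)$, $$\phi_Q(i,p\pm2)=\begin{cases}(\tau_Q^{\mp1}\beta,\,u)&\text{if }\tau_Q^{\mp1}\beta\in\Phi^+,\\(-\tau_Q^{\mp1}\beta,\,u\pm1)&\text{if }\tau_Q^{\mp1}\beta\in\Phi^-.\end{cases}$$ Put $(\Gamma_Q)_0=\phi_Q^{-1}(\Phi^+\times\{0\})$. Then $\mathsf h$ is an integer and is the order of $\tau_Q$, and the following hold. (i) The map $\phi_Q:\widehat\triangle_0\to\Phi^+\times\mathbb Z$ is a bijection. (ii) $(\Gamma_Q)_0=\{(i,p)\in\widehat\triangle_0 : \xi_i\ge p>\xi_{i^*}-\mathsf h\}$, and $\phi_Q(i,p)=\bigl(\tau_Q^{(\xi_i-p)/2}(\gamma_i^Q),\,0\bigr)$ for every $(i,p)\in(\Gamma_Q)_0$. (iii) If $i$ is a source of $Q$, then $(i^*,\xi_i-\mathsf h)\in\widehat\triangle_0$,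 $$\phi_{s_iQ}(i^*,\xi_i-\mathsf h)=\phi_Q(i,\xi_i)=(\alpha_i,0),$$ and $$(\Gamma_{s_iQ})_0=\bigl((\Gamma_Q)_0\setminus\{(i,\xi_i)\}\bigr)\cup\{(i^*,\xi_i-\mathsf h)\}.$$ -/

import Mathlib

/-!
Throughout, `P` is a root system over `ℚ` with a base `b`. The vertex set of the Dynkin diagram is
`b.support` (the simple roots); the finite irreducible reduced crystallographic root systems are
exactly those of type `A`, `B`, `C`, `D`, `E`, `F`, `G`.
-/

namespace DynkinRep

open RootPairing

section

variable {ι M N : Type*} [AddCommGroup M] [Module ℚ M] [AddCommGroup N] [Module ℚ N]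
  {P : RootPairing ι ℚ M N} (b : P.Base)

/-- The simple root `α_i`. -/
def simpleRoot (i : b.support) : M := P.root i

/-- The simple reflection `s_i`. -/
def simpleReflection (i : b.support) : M ≃ₗ[ℚ] M := P.reflection i

/-- The element `s_{i_1} ⋯ s_{i_l}` given by a word in the vertices of the Dynkin diagram. -/
def wordProd (l : List b.support) : M ≃ₗ[ℚ] M := (l.map (simpleReflection b)).prod

/-- The Weyl group, generated by the simple reflections. -/
def weylGroup : Subgroup (M ≃ₗ[ℚ] M) := Subgroup.closure (Set.range (simpleReflection b))

/-- The set `Φ⁺` of positive roots: the roots that are sums of simple roots. -/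
def posRoots : Set M :=
  {x | x ∈ Set.range P.root ∧ x ∈ AddSubmonoid.closure (Set.range (simpleRoot b))}

/-- The length of a Weyl group element: the least number of simple reflections in a word for it. -/
noncomputable def length (w : M ≃ₗ[ℚ] M) : ℕ :=
  sInf {n | ∃ l : List b.support, l.length = n ∧ wordProd b l = w}

/-- `w` is a Weyl group element of the biggest length. -/
def IsLongest (w : M ≃ₗ[ℚ] M) : Prop :=
  w ∈ weylGroup b ∧ ∀ v ∈ weylGroup b, length b v ≤ length b w

/-- The longest element `w₀` (it exists and is unique, as the Weyl group is finite). -/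
noncomputable def longestElement : M ≃ₗ[ℚ] M := Classical.epsilon (IsLongest b)

/-- The involution `i ↦ i^*` of the Dynkin diagram: `i^*` is the vertex with
`w₀ α_i = - α_{i^*}`. -/
noncomputable def star (i : b.support) : b.support :=
  @Classical.epsilon _ ⟨i⟩ fun j => longestElement b (simpleRoot b i) = -simpleRoot b j

/-- The Coxeter number `h = 2 |Φ⁺| / |Δ₀|`. -/
noncomputable def coxeterNumber : ℕ := 2 * (posRoots b).ncard / b.support.card

/-- The vertices `i` and `j` are joined by an edge of the Dynkin diagram. -/
def Adj (i j : b.support) : Prop := P.pairing i j < 0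

/-- The fundamental weight `ϖ_i`: the functional on the coweight space with
`⟨h_j, ϖ_i⟩ = δ_{ij}`, seen as an element of the weight space. -/
noncomputable def fundamentalWeight [P.IsRootSystem] (i : b.support) : M :=
  P.toLinearMap.toPerfPair.symm (b.toCoweightBasis.coord i)

theorem fundamentalWeight_coroot [P.IsRootSystem] (i j : b.support) :
    P.toLinearMap (fundamentalWeight b i) (P.coroot j) =
      open scoped Classical in if j = i then 1 else 0 := by
  classical
  have h : b.toCoweightBasis j = P.coroot j := b.toCoweightBasis_apply j
  rw [fundamentalWeight, LinearMap.apply_symm_toPerfPair_self, ← h]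
  simp [Finsupp.single_apply]

/-- A Dynkin quiver `Q = (Δ, ξ)`: the Dynkin diagram with a height function `ξ`. The arrows of `Q`
are `i → j` for adjacent `i`, `j` with `ξ_i = ξ_j + 1`. -/
structure DynkinQuiver where
  /-- The height function. -/
  ξ : b.support → ℤ
  height : ∀ i j, Adj b i j → |ξ i - ξ j| = 1

variable {b}

namespace DynkinQuiver

/-- `i` is a source of `Q`. -/
def IsSource (Q : DynkinQuiver b) (i : b.support) : Prop := ∀ j, Adj b i j → Q.ξ j < Q.ξ i

end DynkinQuiver

end

section

variable {ι M N : Type*} [Finite ι] [AddCommGroup M] [Module ℚ M] [AddCommGroup N] [Module ℚ N]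
  {P : RootPairing ι ℚ M N} [P.IsCrystallographic] {b : P.Base}

theorem Adj.symm {i j : b.support} (h : Adj b i j) : Adj b j i := by
  have h1 : P.pairing i j < 0 := h
  rw [← P.algebraMap_pairingIn ℤ] at h1
  have h2 : P.pairingIn ℤ i j < 0 := by simpa using h1
  have h3 := P.pairingIn_lt_zero_iff (i := (j : ι)) (j := i) (S := ℤ)
  show P.pairing j i < 0
  rw [← P.algebraMap_pairingIn ℤ]
  simpa using h3.2 h2

namespace DynkinQuiver

/-- The Dynkin quiver `s_i Q` for a source `i`: the height of `i` is lowered by `2`. -/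
noncomputable def reflect (Q : DynkinQuiver b) (i : b.support) (hi : Q.IsSource i) : DynkinQuiver b where
  ξ j := Q.ξ j - open scoped Classical in if j = i then 2 else 0
  height j k hjk := by
    have h := Q.height j k hjk
    split_ifs with h1 h2 h2
    · subst h1; subst h2; simp at h
    · subst h1
      have := hi k hjk
      grind
    · subst h2
      have := hi j hjk.symm
      grind
    · simpa using h

/-- A word `i_1, …, i_l` is `Q`-adapted if `i_k` is a source of `s_{i_{k-1}} ⋯ s_{i_1} Q` for
all `k`. -/
def IsAdapted : DynkinQuiver b → List b.support → Prop
  | _, [] => True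
  | Q, i :: l => ∃ hi : Q.IsSource i, (Q.reflect i hi).IsAdapted l

theorem isAdapted_of_sorted (l : List b.support) (Q : DynkinQuiver b) (hl : l.Nodup)
    (hs : l.Pairwise fun i j => Q.ξ j ≤ Q.ξ i)
    (ho : ∀ i ∈ l, ∀ j ∉ l, Adj b i j → Q.ξ j < Q.ξ i) : Q.IsAdapted l := by
  induction l generalizing Q with
  | nil => trivial
  | cons i l ih =>
    rw [List.nodup_cons] at hl
    rw [List.pairwise_cons] at hs
    have hi : Q.IsSource i := by
      intro j hj
      have h := Q.height i j hj
      by_cases hjl : j ∈ i :: l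
      · rcases List.mem_cons.1 hjl with rfl | hjl
        · simp at h
        · have := hs.1 j hjl
          grind
      · exact ho i (by simp) j hjl hj
    refine ⟨hi, ih _ hl.2 ?_ ?_⟩
    · refine hs.2.imp_of_mem fun {j k} hj hk h => ?_
      have h1 : j ≠ i := fun e => hl.1 (e ▸ hj)
      have h2 : k ≠ i := fun e => hl.1 (e ▸ hk)
      simpa [reflect, h1, h2] using h
    · intro j hj k hk hjk
      have h1 : j ≠ i := fun e => hl.1 (e ▸ hj)
      by_cases hki : k = i
      · subst hki
        have := Q.height j k hjk
        simp only [reflect, h1, if_true, if_false]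
        grind
      · simpa [reflect, h1, hki] using ho j (by simp [hj]) k (by simp [hk, hki]) hjk

theorem simpleReflection_commute {i j : b.support} (hij : i ≠ j) (h : ¬ Adj b i j) :
    Commute (simpleReflection b i) (simpleReflection b j) := by
  have h0 : P.pairingIn ℤ i j ≤ 0 :=
    b.pairingIn_le_zero_of_ne (fun e => hij (Subtype.ext e)) i.2 j.2
  have h1 : ¬ P.pairing i j < 0 := h
  have h2 : P.pairing i j = 0 := by
    rw [← P.algebraMap_pairingIn ℤ] at h1 ⊢
    simp at h1 ⊢
    omega
  exact P.isOrthogonal_comm _ _ ⟨h2, P.pairing_eq_zero_iff.1 h2⟩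

theorem isAdapted_move (u v : List b.support) (Q : DynkinQuiver b) (i : b.support)
    (hi : Q.IsSource i) (hu : i ∉ u) (h : Q.IsAdapted (u ++ i :: v)) :
    (Q.reflect i hi).IsAdapted (u ++ v) ∧
      wordProd b (u ++ i :: v) = simpleReflection b i * wordProd b (u ++ v) := by
  induction u generalizing Q with
  | nil =>
    obtain ⟨_, h⟩ := h
    exact ⟨h, by simp [wordProd]⟩
  | cons j u ih =>
    obtain ⟨hj, h⟩ := h
    have hij : i ≠ j := fun e => hu (by simp [e])
    have hadj : ¬ Adj b i j := fun e => lt_asymm (hi j e) (hj i e.symm)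
    have hi' : (Q.reflect j hj).IsSource i := by
      intro k hk
      have := hi k hk
      simp only [reflect, hij, if_false]
      split_ifs <;> omega
    have hj' : (Q.reflect i hi).IsSource j := by
      intro k hk
      have := hj k hk
      simp only [reflect, hij.symm, if_false]
      split_ifs <;> omega
    obtain ⟨h1, h2⟩ := ih _ hi' (fun e => hu (by simp [e])) h
    have e : (Q.reflect j hj).reflect i hi' = (Q.reflect i hi).reflect j hj' := by
      simp only [reflect, DynkinQuiver.mk.injEq]
      funext k
      ring
    refine ⟨⟨hj', e ▸ h1⟩, ?_⟩
    have h3 := (simpleReflection_commute hij hadj).eq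
    simp only [wordProd, List.cons_append, List.map_cons, List.prod_cons] at h2 ⊢
    rw [h2, ← mul_assoc, ← mul_assoc, h3]

theorem wordProd_eq_of_isAdapted (l l' : List b.support) (Q : DynkinQuiver b)
    (hl : l.Nodup) (hl' : l'.Nodup) (hm : ∀ i, i ∈ l ↔ i ∈ l')
    (h : Q.IsAdapted l) (h' : Q.IsAdapted l') : wordProd b l = wordProd b l' := by
  induction l generalizing Q l' with
  | nil =>
    have : l' = [] := List.eq_nil_iff_forall_not_mem.2 fun i hi => by simpa using (hm i).2 hi
    rw [this]
  | cons i l ih =>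
    obtain ⟨u, v, rfl⟩ := List.append_of_mem ((hm i).1 (by simp))
    obtain ⟨hi, h⟩ := h
    rw [List.nodup_middle, List.nodup_cons] at hl'
    rw [List.nodup_cons] at hl
    obtain ⟨h1, h2⟩ := isAdapted_move u v Q i hi (fun e => hl'.1 (by simp [e])) h'
    rw [h2, ← ih (u ++ v) (Q.reflect i hi) hl.2 hl'.2 ?_ h h1]
    · simp [wordProd]
    · intro k
      have hk := hm k
      by_cases hki : k = i
      · subst hki
        exact iff_of_false hl.1 hl'.1
      · simpa [hki] using hk

/-- There is exactly one Coxeter element with a `Q`-adapted reduced expression. A word in which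
each vertex occurs exactly once is automatically reduced. -/
theorem existsUnique_coxeterElement (Q : DynkinQuiver b) :
    ∃! τ : M ≃ₗ[ℚ] M, ∃ l : List b.support,
      l.Nodup ∧ (∀ i, i ∈ l) ∧ Q.IsAdapted l ∧ wordProd b l = τ := by
  classical
  let r : b.support → b.support → Prop := fun i j => Q.ξ j ≤ Q.ξ i
  have : Std.Total r := ⟨fun i j => le_total _ _⟩
  have : IsTrans b.support r := ⟨fun i j k h1 h2 => le_trans h2 h1⟩
  let l := (Finset.univ : Finset b.support).toList.insertionSort r
  have hp : l.Perm (Finset.univ : Finset b.support).toList := List.perm_insertionSort _ _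
  have hn : l.Nodup := hp.nodup_iff.2 (Finset.nodup_toList _)
  have hm : ∀ i, i ∈ l := fun i => hp.mem_iff.2 (by simp)
  have ha : Q.IsAdapted l := isAdapted_of_sorted l Q hn (List.pairwise_insertionSort r _)
    fun i _ j hj => absurd (hm j) hj
  refine ⟨wordProd b l, ⟨l, hn, hm, ha, rfl⟩, ?_⟩
  rintro _ ⟨l', hn', hm', ha', rfl⟩
  exact wordProd_eq_of_isAdapted l' l Q hn' hn (fun i => by simp [hm, hm']) ha' ha

/-- The Coxeter element `τ_Q`. -/
noncomputable def coxeterElement (Q : DynkinQuiver b) : M ≃ₗ[ℚ] M :=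
  Q.existsUnique_coxeterElement.choose

/-- `γ_i^Q = (1 - τ_Q) ϖ_i`. -/
noncomputable def γ [P.IsRootSystem] (Q : DynkinQuiver b) (i : b.support) : M :=
  fundamentalWeight b i - Q.coxeterElement (fundamentalWeight b i)

/-- The vertex set `Δ̂₀` of the repetition quiver. -/
def repVertices (Q : DynkinQuiver b) : Set (b.support × ℤ) := {x | Even (x.2 - Q.ξ x.1)}

open scoped Classical in
/-- The map `(β, u) ↦ (w β, u)` if `w β` is a positive root and `(β, u) ↦ (-w β, u + ε)`
if `w β` is a negative root. -/
noncomputable def signedStep (b : P.Base) (w : M ≃ₗ[ℚ] M) (ε : ℤ) (x : M × ℤ) : M × ℤ :=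
  if w x.1 ∈ posRoots b then (w x.1, x.2) else (-w x.1, x.2 + ε)

/-- The values `φ_Q(i, ξ_i - 2k)` for `k : ℤ`, defined inductively from
`φ_Q(i, ξ_i) = (γ_i^Q, 0)`: lowering the second coordinate `p` of a vertex by `2` applies `τ_Q`,
raising it by `2` applies `τ_Q⁻¹`. -/
noncomputable def φAux [P.IsRootSystem] (Q : DynkinQuiver b) (i : b.support) : ℤ → M × ℤ
  | Int.ofNat n => (signedStep b Q.coxeterElement (-1))^[n] (Q.γ i, 0)
  | Int.negSucc n => (signedStep b Q.coxeterElement⁻¹ 1)^[n + 1] (Q.γ i, 0)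

/-- The map `φ_Q`. Only its values on `Q.repVertices`, where `ξ_i - p` is even, are meaningful. -/
noncomputable def φ [P.IsRootSystem] (Q : DynkinQuiver b) (x : b.support × ℤ) : M × ℤ :=
  Q.φAux x.1 ((Q.ξ x.1 - x.2) / 2)

/-- The vertex set `(Γ_Q)₀ = φ_Q⁻¹(Φ⁺ × {0})` of the full subquiver `Γ_Q` of the repetition
quiver. -/
def arVertices [P.IsRootSystem] (Q : DynkinQuiver b) : Set (b.support × ℤ) :=
  {x | x ∈ Q.repVertices ∧ Q.φ x ∈ posRoots b ×ˢ ({0} : Set ℤ)}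

end DynkinQuiver

end

end DynkinRep

/-! Write `τ` for the Coxeter element. Lowering `p` by 2 is a permutation `step` of `Φ⁺ × ℤ`: apply
`τ` and, when the result is negative, change its sign and drop one level. In an adapted word `τ = u
s_j v` the weight `ϖ_j` is moved only by `s_j`, so `γ_j = u α_j`, and the `γ_j` are exactly the
positive roots made negative by `τ⁻¹`. Hence a step drops a level exactly when it lands on some
`(γ_i, u)`. Since `τ` has finite order and no nonzero fixed vector, every orbit goes through all
levels, one at a time, and enters each level at exactly one such point. Orbits are thus indexed by
vertices, which is (i).

For the window in (ii), let `m_i` be the number of steps from `(γ_i, 0)` to level `-1`, entered at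
`(γ_{κ i}, -1)`. Cancelling `1 - τ` gives `τ^{m_i} ϖ_i = -ϖ_{κ i}`. A coefficient argument
(`sub_le`) shows that `ξ - 2m` is again a height function, so it is reached from `ξ` by source
reflections, whose product `w` satisfies `w ϖ_i = τ^{m_i} ϖ_i` (`exists_weylGroup_of_le`). Therefore
`w` sends each `α_i` to `-α_{κ i}`, which means `w = w₀` and `κ = star`. The coefficients of the
`γ_j` at neighbours detect the orientation of the quiver, so `ξ - 2m` and `ξ ∘ κ` differ by a
constant on the connected diagram. Summing over the vertices, with `∑ m_i = |Φ⁺|`, identifies this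
constant as the Coxeter number `h`.

Two successive drops take `m_i + m_{i*} = h` steps, so `step ^ h` lowers the level by 2; this yields
the order of `τ`. Part (iii) is the same window computed for `s_iQ`. -/

namespace DynkinRep

open RootPairing

/-! ### Positive roots, coefficients and words in simple reflections -/

section Basics

variable {ι M N : Type*} [AddCommGroup M] [Module ℚ M] [AddCommGroup N] [Module ℚ N]
  {P : RootPairing ι ℚ M N} (b : P.Base)

/-- The pairing with the simple coroot `h_i`. -/
noncomputable def copair (i : b.support) : M →ₗ[ℚ] ℚ := P.coroot' i

theorem simpleReflection_apply (i : b.support) (x : M) :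
    simpleReflection b i x = x - copair b i x • simpleRoot b i :=
  P.reflection_apply i x

theorem simpleReflection_mul_self (i : b.support) :
    simpleReflection b i * simpleReflection b i = 1 := by
  ext x
  simp [simpleReflection]

theorem simpleReflection_inv (i : b.support) :
    (simpleReflection b i)⁻¹ = simpleReflection b i :=
  inv_eq_of_mul_eq_one_left (simpleReflection_mul_self b i)

theorem simpleReflection_simpleReflection (i : b.support) (x : M) :
    simpleReflection b i (simpleReflection b i x) = x := by
  simp [simpleReflection]

theorem simpleReflection_simpleRoot (i : b.support) :
    simpleReflection b i (simpleRoot b i) = -simpleRoot b i :=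
  P.reflection_apply_self i

theorem copair_simpleRoot (i j : b.support) :
    copair b j (simpleRoot b i) = P.pairing i j := rfl

theorem image_root_support :
    P.root '' b.support = Set.range (simpleRoot b) := by
  ext x
  simp [simpleRoot]

theorem mem_posRoots_or_neg {x : M} (hx : x ∈ Set.range P.root) :
    x ∈ posRoots b ∨ -x ∈ posRoots b := by
  obtain ⟨i, rfl⟩ := hx
  have h := b.root_mem_or_neg_mem i
  rw [image_root_support] at h
  exact h.imp (fun h => ⟨⟨i, rfl⟩, h⟩) fun h => ⟨P.neg_mem_range_root_iff.2 ⟨i, rfl⟩, h⟩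

theorem ne_zero_of_mem_range {x : M} (hx : x ∈ Set.range P.root) : x ≠ 0 := by
  obtain ⟨i, rfl⟩ := hx
  exact P.ne_zero i

theorem simpleRoot_mem_posRoots (i : b.support) : simpleRoot b i ∈ posRoots b :=
  ⟨⟨i, rfl⟩, AddSubmonoid.subset_closure ⟨i, rfl⟩⟩

theorem simpleReflection_mem_range (i : b.support) {x : M} (hx : x ∈ Set.range P.root) :
    simpleReflection b i x ∈ Set.range P.root := by
  obtain ⟨j, rfl⟩ := hx
  exact ⟨P.reflectionPerm i j, P.root_reflectionPerm i j⟩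

@[simp] theorem wordProd_nil : wordProd b [] = 1 := rfl

theorem wordProd_cons (i : b.support) (l : List b.support) :
    wordProd b (i :: l) = simpleReflection b i * wordProd b l := by simp [wordProd]

theorem wordProd_append (l l' : List b.support) :
    wordProd b (l ++ l') = wordProd b l * wordProd b l' := by simp [wordProd]

theorem wordProd_reverse (l : List b.support) : wordProd b l.reverse = (wordProd b l)⁻¹ := by
  induction l with
  | nil => simp
  | cons i l ih =>
    rw [List.reverse_cons, wordProd_append, ih, wordProd_cons, wordProd_cons, wordProd_nil,
      mul_inv_rev, mul_one, simpleReflection_inv]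

theorem simpleReflection_mem_weylGroup (i : b.support) : simpleReflection b i ∈ weylGroup b :=
  Subgroup.subset_closure ⟨i, rfl⟩

theorem wordProd_mem_weylGroup (l : List b.support) : wordProd b l ∈ weylGroup b := by
  induction l with
  | nil => exact one_mem _
  | cons i l ih =>
    rw [wordProd_cons]
    exact mul_mem (simpleReflection_mem_weylGroup b i) ih

theorem exists_wordProd_eq {w : M ≃ₗ[ℚ] M} (hw : w ∈ weylGroup b) : ∃ l, wordProd b l = w := by
  induction hw using Subgroup.closure_induction with
  | mem x hx =>
    obtain ⟨i, rfl⟩ := hx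
    exact ⟨[i], by simp [wordProd]⟩
  | one => exact ⟨[], rfl⟩
  | mul x y _ _ hx hy =>
    obtain ⟨l, rfl⟩ := hx
    obtain ⟨l', rfl⟩ := hy
    exact ⟨l ++ l', wordProd_append b l l'⟩
  | inv x _ hx =>
    obtain ⟨l, rfl⟩ := hx
    exact ⟨l.reverse, wordProd_reverse b l⟩

theorem wordProd_mem_range (l : List b.support) {x : M} (hx : x ∈ Set.range P.root) :
    wordProd b l x ∈ Set.range P.root := by
  induction l with
  | nil => exact hx
  | cons i l ih =>
    rw [wordProd_cons]
    exact simpleReflection_mem_range b i ih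

theorem weylGroup_mem_range {w : M ≃ₗ[ℚ] M} (hw : w ∈ weylGroup b) {x : M}
    (hx : x ∈ Set.range P.root) : w x ∈ Set.range P.root := by
  obtain ⟨l, rfl⟩ := exists_wordProd_eq b hw
  exact wordProd_mem_range b l hx

variable [P.IsRootSystem]

/-- The coefficient of the simple root `α_i`. -/
noncomputable def coeff (i : b.support) : M →ₗ[ℚ] ℚ := b.toWeightBasis.coord i

theorem simpleRoot_eq (i : b.support) : simpleRoot b i = b.toWeightBasis i := by
  simp [simpleRoot]

theorem coeff_simpleRoot (i j : b.support) [Decidable (j = i)] :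
    coeff b i (simpleRoot b j) = if j = i then 1 else 0 := by
  rw [simpleRoot_eq, coeff, Module.Basis.coord_apply, Module.Basis.repr_self, Finsupp.single_apply]

theorem sum_coeff (x : M) : ∑ i, coeff b i x • simpleRoot b i = x := by
  simp_rw [simpleRoot_eq]
  exact b.toWeightBasis.sum_repr x

theorem ext_coeff {x y : M} (h : ∀ i, coeff b i x = coeff b i y) : x = y :=
  b.toWeightBasis.ext_elem h

theorem coeff_simpleReflection_of_ne {i j : b.support} (h : i ≠ j) (x : M) :
    coeff b j (simpleReflection b i x) = coeff b j x := by
  classical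
  rw [simpleReflection_apply, map_sub, map_smul, coeff_simpleRoot, if_neg h]
  simp

theorem copair_fundamentalWeight (i j : b.support) [Decidable (j = i)] :
    copair b j (fundamentalWeight b i) = if j = i then 1 else 0 := by
  rw [copair]
  refine (fundamentalWeight_coroot b i j).trans ?_
  congr

theorem simpleReflection_fundamentalWeight (i : b.support) :
    simpleReflection b i (fundamentalWeight b i) = fundamentalWeight b i - simpleRoot b i := by
  classical
  rw [simpleReflection_apply, copair_fundamentalWeight, if_pos rfl, one_smul]

theorem simpleReflection_fundamentalWeight_of_ne {i j : b.support} (h : j ≠ i) :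
    simpleReflection b j (fundamentalWeight b i) = fundamentalWeight b i := by
  classical
  rw [simpleReflection_apply, copair_fundamentalWeight, if_neg h, zero_smul, sub_zero]

theorem eq_zero_of_copair {x : M} (h : ∀ i, copair b i x = 0) : x = 0 := by
  have h1 : P.toLinearMap x = 0 := b.toCoweightBasis.ext fun i => by
    rw [b.toCoweightBasis_apply i]
    exact h i
  exact P.toLinearMap.toPerfPair.injective (by simpa using h1)

theorem coeff_nonneg {x : M} (hx : x ∈ posRoots b) (i : b.support) : 0 ≤ coeff b i x := by
  classical
  refine AddSubmonoid.closure_induction ?_ (by simp) (fun x y _ _ hx hy => ?_) hx.2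
  · rintro _ ⟨j, rfl⟩
    rw [coeff_simpleRoot]
    split_ifs <;> norm_num
  · rw [map_add]
    exact add_nonneg hx hy

theorem exists_coeff_pos {x : M} (hx : x ∈ posRoots b) : ∃ i, 0 < coeff b i x := by
  by_contra! h
  exact ne_zero_of_mem_range hx.1
    (ext_coeff b fun i => by rw [map_zero]; exact le_antisymm (h i) (coeff_nonneg b hx i))

theorem mem_posRoots_of_coeff_pos {x : M} (hx : x ∈ Set.range P.root) {i : b.support}
    (hi : 0 < coeff b i x) : x ∈ posRoots b := by
  refine (mem_posRoots_or_neg b hx).resolve_right fun h => ?_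
  have := coeff_nonneg b h i
  rw [map_neg] at this
  linarith

theorem mem_posRoots_iff {x : M} (hx : x ∈ Set.range P.root) :
    x ∈ posRoots b ↔ ∀ i, 0 ≤ coeff b i x := by
  refine ⟨fun h i => coeff_nonneg b h i, fun h => ?_⟩
  refine (mem_posRoots_or_neg b hx).resolve_right fun h' => ?_
  obtain ⟨i, hi⟩ := exists_coeff_pos b h'
  have := h i
  rw [map_neg] at hi
  linarith

theorem neg_notMem_posRoots {x : M} (hx : x ∈ posRoots b) : -x ∉ posRoots b := by
  intro h
  obtain ⟨i, hi⟩ := exists_coeff_pos b hx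
  have := coeff_nonneg b h i
  rw [map_neg] at this
  linarith

theorem neg_mem_posRoots_iff {x : M} (hx : x ∈ Set.range P.root) :
    -x ∈ posRoots b ↔ x ∉ posRoots b :=
  ⟨fun h h' => neg_notMem_posRoots b h' h, fun h => (mem_posRoots_or_neg b hx).resolve_left h⟩

theorem coeff_wordProd_of_notMem {l : List b.support} {i : b.support} (h : i ∉ l) (x : M) :
    coeff b i (wordProd b l x) = coeff b i x := by
  induction l with
  | nil => rfl
  | cons j l ih =>
    rw [List.mem_cons, not_or] at h
    rw [wordProd_cons, LinearEquiv.mul_apply, coeff_simpleReflection_of_ne b (Ne.symm h.1), ih h.2]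

theorem wordProd_fundamentalWeight_of_notMem {l : List b.support} {i : b.support} (h : i ∉ l) :
    wordProd b l (fundamentalWeight b i) = fundamentalWeight b i := by
  induction l with
  | nil => rfl
  | cons j l ih =>
    rw [List.mem_cons, not_or] at h
    rw [wordProd_cons, LinearEquiv.mul_apply, ih h.2,
      simpleReflection_fundamentalWeight_of_ne b (Ne.symm h.1)]

/-- A vector fixed by a product of distinct simple reflections is fixed by each of them. -/
theorem copair_eq_zero_of_wordProd {l : List b.support} (hl : l.Nodup) {x : M}
    (h : wordProd b l x = x) : ∀ i ∈ l, copair b i x = 0 := by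
  classical
  induction l with
  | nil => simp
  | cons i l ih =>
    rw [List.nodup_cons] at hl
    have h1 : wordProd b l x = simpleReflection b i x := by
      rw [wordProd_cons, LinearEquiv.mul_apply] at h
      conv_rhs => rw [← h]
      rw [simpleReflection_simpleReflection]
    have h2 := coeff_wordProd_of_notMem b hl.1 x
    rw [h1, simpleReflection_apply, map_sub, map_smul, coeff_simpleRoot, if_pos rfl] at h2
    have h3 : copair b i x = 0 := by simpa using h2
    rw [simpleReflection_apply, h3, zero_smul, sub_zero] at h1
    intro j hj
    rcases List.mem_cons.1 hj with rfl | hj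
    · exact h3
    · exact ih hl.2 h1 j hj

variable [Finite ι]

theorem eq_simpleRoot_of_coeff {x : M} (hx : x ∈ posRoots b) {i : b.support}
    (h : ∀ j, j ≠ i → coeff b j x = 0) : x = simpleRoot b i := by
  have h1 : x = coeff b i x • simpleRoot b i := by
    conv_lhs => rw [← sum_coeff b x]
    exact Finset.sum_eq_single i (fun j _ hj => by rw [h j hj, zero_smul]) (by simp)
  have : IsAddTorsionFree M := .of_module_rat M
  have : IsAddTorsionFree N := .of_module_rat N
  rcases b.eq_one_or_neg_one_of_mem_support_of_smul_mem i i.2 (coeff b i x)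
    (by have := hx.1; rw [h1] at this; exact this) with h2 | h2
  · rw [h1, h2, one_smul]
  · have := coeff_nonneg b hx i
    linarith

/-- A positive root other than `α_i` has a positive coefficient away from `i`, and `s_i` leaves that
coefficient alone. -/
theorem simpleReflection_mem_posRoots {i : b.support} {x : M} (hx : x ∈ posRoots b)
    (hi : x ≠ simpleRoot b i) : simpleReflection b i x ∈ posRoots b := by
  obtain ⟨j, hj, h⟩ : ∃ j, j ≠ i ∧ coeff b j x ≠ 0 := by
    by_contra! h
    exact hi (eq_simpleRoot_of_coeff b hx h)
  refine mem_posRoots_of_coeff_pos b (simpleReflection_mem_range b i hx.1) (i := j) ?_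
  rw [coeff_simpleReflection_of_ne b hj.symm]
  exact lt_of_le_of_ne (coeff_nonneg b hx j) h.symm

/-- The group acts faithfully on the finite set of roots, since the simple roots span. -/
theorem finite_weylGroup : Finite (weylGroup b) := by
  have hf : Finite (Set.range P.root) := Set.finite_range _ |>.to_subtype
  let f : weylGroup b → (Set.range P.root → Set.range P.root) := fun w x =>
    ⟨w.1 x, weylGroup_mem_range b w.2 x.2⟩
  refine Finite.of_injective f fun w v h => Subtype.ext ?_
  refine LinearEquiv.toLinearMap_injective (b.toWeightBasis.ext fun i => ?_)
  rw [← simpleRoot_eq]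
  have := congr_arg Subtype.val (congr_fun h ⟨simpleRoot b i, i, rfl⟩)
  exact this

variable [P.IsCrystallographic]

omit [P.IsRootSystem] in
theorem copair_simpleRoot_nonpos {i j : b.support} (h : i ≠ j) :
    copair b j (simpleRoot b i) ≤ 0 := by
  have h0 : P.pairingIn ℤ i j ≤ 0 :=
    b.pairingIn_le_zero_of_ne (fun e => h (Subtype.ext e)) i.2 j.2
  rw [copair_simpleRoot, ← P.algebraMap_pairingIn ℤ]
  simpa using h0

/-- The coefficients of `s_u α_j`, for a word `u` with distinct letters, none of them `j`. -/
theorem coeff_wordProd_simpleRoot {u : List b.support} (hu : u.Nodup) {j : b.support}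
    (hj : j ∉ u) :
    (∀ i, 0 ≤ coeff b i (wordProd b u (simpleRoot b j))) ∧
      ∀ i ∈ u, Adj b j i → 0 < coeff b i (wordProd b u (simpleRoot b j)) := by
  classical
  induction u with
  | nil =>
    refine ⟨fun i => ?_, by simp⟩
    exact coeff_nonneg b (simpleRoot_mem_posRoots b j) i
  | cons k u ih =>
    rw [List.nodup_cons] at hu
    rw [List.mem_cons, not_or] at hj
    obtain ⟨h1, h2⟩ := ih hu.2 hj.2
    set x := wordProd b u (simpleRoot b j) with hx
    have hxj : coeff b j x = 1 := by
      rw [hx, coeff_wordProd_of_notMem b hj.2, coeff_simpleRoot, if_pos rfl]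
    have hxk : coeff b k x = 0 := by
      rw [hx, coeff_wordProd_of_notMem b hu.1, coeff_simpleRoot, if_neg hj.1]
    -- Here `x` is `α_j` plus a nonnegative combination of simple roots other than `α_k`, each
    -- pairing nonpositively with `h_k`. The new `k`-coefficient is therefore at least `-⟨h_k,
    -- α_j⟩`.
    have hc : copair b k x ≤ copair b k (simpleRoot b j) := by
      conv_lhs => rw [← sum_coeff b x]
      rw [map_sum, ← Finset.add_sum_erase _ _ (Finset.mem_univ j), map_smul, hxj, one_smul]
      refine add_le_of_nonpos_right (Finset.sum_nonpos fun i _ => ?_)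
      rw [map_smul, smul_eq_mul]
      rcases eq_or_ne i k with rfl | hik
      · rw [hxk, zero_mul]
      · exact mul_nonpos_of_nonneg_of_nonpos (h1 i) (copair_simpleRoot_nonpos b hik)
    have hk : coeff b k (simpleReflection b k x) = -copair b k x := by
      rw [simpleReflection_apply, map_sub, map_smul, coeff_simpleRoot, if_pos rfl, hxk]
      simp
    rw [wordProd_cons, LinearEquiv.mul_apply, ← hx]
    refine ⟨fun i => ?_, fun i hi hij => ?_⟩
    · rcases eq_or_ne k i with rfl | hki
      · rw [hk]
        have := copair_simpleRoot_nonpos b hj.1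
        linarith
      · rw [coeff_simpleReflection_of_ne b hki]
        exact h1 i
    · rcases eq_or_ne k i with rfl | hki
      · rw [hk]
        have : copair b k (simpleRoot b j) < 0 := hij
        linarith
      · rw [coeff_simpleReflection_of_ne b hki]
        exact h2 i ((List.mem_cons.1 hi).resolve_left hki.symm) hij

theorem wordProd_simpleRoot_mem_posRoots {u : List b.support} (hu : u.Nodup) {j : b.support}
    (hj : j ∉ u) : wordProd b u (simpleRoot b j) ∈ posRoots b :=
  (mem_posRoots_iff b (wordProd_mem_range b u ⟨j, rfl⟩)).2 (coeff_wordProd_simpleRoot b hu hj).1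

end Basics

/-! ### Invariant form, exchange condition and the longest element -/

section Longest

variable {ι M N : Type*} [Finite ι] [AddCommGroup M] [Module ℚ M] [AddCommGroup N] [Module ℚ N]
  {P : RootPairing ι ℚ M N} (b : P.Base)

/-- There is a bilinear form that is invariant under the Weyl group and for which the simple roots
are positive multiples of the simple coroots. -/
theorem exists_invariant_bilinForm : ∃ (B : LinearMap.BilinForm ℚ M) (d : b.support → ℚ),
    (∀ i, 0 < d i) ∧ (∀ w ∈ weylGroup b, ∀ x y, B (w x) (w y) = B x y) ∧
      ∀ i x, B x (simpleRoot b i) = d i * copair b i x := by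
  have := Fintype.ofFinite ι
  refine ⟨P.RootForm, fun i => P.RootForm (P.root i) (P.root i) / 2, fun i => ?_, ?_, ?_⟩
  · dsimp only
    rw [P.rootForm_root_self]
    refine div_pos (Finset.sum_pos' (fun j _ => mul_self_nonneg _) ⟨i, Finset.mem_univ _, ?_⟩)
      two_pos
    simp
  · intro w hw
    obtain ⟨l, rfl⟩ := exists_wordProd_eq b hw
    induction l with
    | nil => exact fun x y => rfl
    | cons i l ih =>
      intro x y
      rw [wordProd_cons]
      exact (P.rootForm_reflection_reflection_apply i _ _).trans
        (ih (wordProd_mem_weylGroup b l) x y)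
  · intro i x
    have h := congr_arg (P.toLinearMap x) (P.rootForm_self_smul_coroot i)
    rw [map_smul, map_nsmul, P.toLinearMap_apply_apply_Polarization, smul_eq_mul] at h
    have hs : P.RootForm (P.root i) x = P.RootForm x (P.root i) := by
      simp [P.rootForm_apply_apply, mul_comm]
    rw [hs] at h
    have hc : copair b i x = P.toLinearMap x (P.coroot i) := rfl
    rw [hc, simpleRoot]
    simp only [nsmul_eq_mul, Nat.cast_ofNat] at h
    linarith

/-- The invariant form on two simple roots has the sign of their Cartan integer, and the two minus
signs cancel. -/
theorem Adj.of_apply_eq_neg {b : P.Base} {w : M ≃ₗ[ℚ] M} (hw : w ∈ weylGroup b) {i j k l : b.support}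
    (hi : w (simpleRoot b i) = -simpleRoot b k) (hj : w (simpleRoot b j) = -simpleRoot b l)
    (h : Adj b i j) : Adj b k l := by
  obtain ⟨B, d, hd, hB, h1⟩ := exists_invariant_bilinForm b
  have h2 := hB w hw (simpleRoot b i) (simpleRoot b j)
  rw [hi, hj, map_neg, map_neg, LinearMap.neg_apply, neg_neg, h1, h1] at h2
  have h3 : copair b j (simpleRoot b i) < 0 := h
  have h4 : d j * copair b j (simpleRoot b i) < 0 := mul_neg_of_pos_of_neg (hd j) h3
  rw [← h2] at h4
  exact (pos_iff_neg_of_mul_neg h4).1 (hd l)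

variable [P.IsRootSystem]

/-- Pairing with `ϖ_i` in the invariant form reads off the `i`-th coefficient up to the factor `d
i`, so invariance turns a relation between weights into one between coefficients. Only the sign of
`c` matters later. -/
theorem exists_coeff_inv_eq {w : M ≃ₗ[ℚ] M} (hw : w ∈ weylGroup b) {i k : b.support}
    (h : w (fundamentalWeight b i) = -fundamentalWeight b k) :
    ∃ c : ℚ, 0 < c ∧ ∀ x, coeff b i (w⁻¹ x) = -(c * coeff b k x) := by
  classical
  obtain ⟨B, d, hd, hB, h1⟩ := exists_invariant_bilinForm b
  have h2 : ∀ i x, B (fundamentalWeight b i) x = d i * coeff b i x := by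
    intro i x
    conv_lhs => rw [← sum_coeff b x]
    simp only [map_sum, map_smul, h1, smul_eq_mul, copair_fundamentalWeight]
    simp [mul_comm]
  refine ⟨d k / d i, div_pos (hd k) (hd i), fun x => ?_⟩
  have h3 := hB w hw (fundamentalWeight b i) (w⁻¹ x)
  have h4 : w (w⁻¹ x) = x := w.apply_symm_apply x
  rw [h4, h, map_neg, LinearMap.neg_apply, h2, h2] at h3
  have := (hd i).ne'
  field_simp
  linarith

/-- The exchange condition. -/
theorem exists_wordProd_eq_mul (l : List b.support) (i : b.support)
    (h : wordProd b l (simpleRoot b i) ∉ posRoots b) :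
    ∃ l' : List b.support, l'.length + 1 = l.length ∧
      wordProd b l' = wordProd b l * simpleReflection b i := by
  induction l with
  | nil => exact absurd (simpleRoot_mem_posRoots b i) h
  | cons j l ih =>
    by_cases h1 : wordProd b l (simpleRoot b i) ∈ posRoots b
    · refine ⟨l, rfl, ?_⟩
      have h2 : wordProd b l (simpleRoot b i) = simpleRoot b j := by
        by_contra h2
        exact h (by rw [wordProd_cons]; exact simpleReflection_mem_posRoots b h1 h2)
      -- An element taking `α_i` to `α_j` conjugates `s_i` to `s_j`: both roots have the same norm,
      -- so `d i = d j`, and the coroots correspond as well.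
      have h3 : wordProd b l * simpleReflection b i = simpleReflection b j * wordProd b l := by
        ext x
        have hc : copair b i x = copair b j (wordProd b l x) := by
          obtain ⟨B, d, hd, hB, h4⟩ := exists_invariant_bilinForm b
          have h5 := hB _ (wordProd_mem_weylGroup b l) x (simpleRoot b i)
          have h6 := hB _ (wordProd_mem_weylGroup b l) (simpleRoot b i) (simpleRoot b i)
          have h7 : ∀ k, copair b k (simpleRoot b k) = 2 := fun k => P.pairing_same k
          rw [h2, h4, h4] at h5 h6
          rw [h7, h7] at h6
          have h8 : d j = d i := by linarith
          rw [h8] at h5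
          exact (mul_left_cancel₀ (hd i).ne' h5).symm
        rw [LinearEquiv.mul_apply, LinearEquiv.mul_apply, simpleReflection_apply,
          simpleReflection_apply, map_sub, map_smul, h2, hc]
      rw [wordProd_cons, mul_assoc, h3, ← mul_assoc, simpleReflection_mul_self, one_mul]
    · obtain ⟨l', h2, h3⟩ := ih h1
      refine ⟨j :: l', by simp [h2], ?_⟩
      rw [wordProd_cons, h3, wordProd_cons, mul_assoc]

omit [Finite ι] [P.IsRootSystem] in
theorem exists_wordProd_length {w : M ≃ₗ[ℚ] M} (hw : w ∈ weylGroup b) :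
    ∃ l : List b.support, l.length = length b w ∧ wordProd b l = w := by
  obtain ⟨l, hl⟩ := exists_wordProd_eq b hw
  exact Nat.sInf_mem (s := {n | ∃ l : List b.support, l.length = n ∧ wordProd b l = w})
    ⟨_, l, rfl, hl⟩

omit [Finite ι] [P.IsRootSystem] in
theorem length_wordProd_le (l : List b.support) : length b (wordProd b l) ≤ l.length :=
  Nat.sInf_le ⟨l, rfl, rfl⟩

/-- A Weyl group element that preserves the positive roots is trivial. -/
theorem eq_one_of_simpleRoot_mem_posRoots {w : M ≃ₗ[ℚ] M} (hw : w ∈ weylGroup b)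
    (h : ∀ i, w (simpleRoot b i) ∈ posRoots b) : w = 1 := by
  obtain ⟨l, hl, rfl⟩ := exists_wordProd_length b hw
  rcases List.eq_nil_or_concat l with rfl | ⟨l', i, rfl⟩
  · rfl
  have hi := h i
  have he : wordProd b (l'.concat i) = wordProd b l' * simpleReflection b i := by
    simp [wordProd]
  rw [he, LinearEquiv.mul_apply, simpleReflection_simpleRoot, map_neg] at hi
  -- The shortest word ends in `i`, so dropping that letter makes the image of `α_i` negative;
  -- exchange then writes the element with two letters fewer.
  have h2 : wordProd b l' (simpleRoot b i) ∉ posRoots b := by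
    intro h3
    exact neg_notMem_posRoots b h3 hi
  obtain ⟨l'', h3, h4⟩ := exists_wordProd_eq_mul b l' i h2
  have h5 := length_wordProd_le b l''
  rw [h4, ← he, ← hl] at h5
  simp at h5
  omega

omit [P.IsRootSystem] [Finite ι] in
theorem mem_posRoots_of_simpleRoot (f : M →ₗ[ℚ] M) (hf : ∀ x ∈ Set.range P.root,
    f x ∈ Set.range P.root) (h : ∀ i, f (simpleRoot b i) ∈ posRoots b) {x : M}
    (hx : x ∈ posRoots b) : f x ∈ posRoots b := by
  refine ⟨hf x hx.1, ?_⟩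
  refine AddSubmonoid.closure_induction ?_ (by simp) (fun x y _ _ hx hy => ?_) hx.2
  · rintro _ ⟨i, rfl⟩
    exact (h i).2
  · rw [map_add]
    exact add_mem hx hy

/-- The quotient `v⁻¹ w` keeps simple roots positive, hence is trivial. This is how `w₀` is
recognised. -/
theorem eq_of_neg_mem_posRoots {v w : M ≃ₗ[ℚ] M} (hv : v ∈ weylGroup b) (hw : w ∈ weylGroup b)
    (hv' : ∀ i, -v (simpleRoot b i) ∈ posRoots b)
    (hw' : ∀ i, -w (simpleRoot b i) ∈ posRoots b) : v = w := by
  have hv2 : ∀ x ∈ posRoots b, -v x ∈ posRoots b := fun x hx =>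
    mem_posRoots_of_simpleRoot b (-v.toLinearMap)
      (fun x hx => P.neg_mem_range_root_iff.2 (weylGroup_mem_range b hv hx)) hv' hx
  have h : v⁻¹ * w = 1 := by
    refine eq_one_of_simpleRoot_mem_posRoots b (mul_mem (inv_mem hv) hw) fun i => ?_
    have hr : (v⁻¹ * w) (simpleRoot b i) ∈ Set.range P.root :=
      weylGroup_mem_range b (mul_mem (inv_mem hv) hw) ⟨i, rfl⟩
    by_contra h
    have h1 := hv2 _ ((neg_mem_posRoots_iff b hr).2 h)
    rw [map_neg, neg_neg, ← LinearEquiv.mul_apply, mul_inv_cancel_left] at h1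
    exact neg_notMem_posRoots b h1 (hw' i)
  exact inv_mul_eq_one.1 h

theorem exists_isLongest : ∃ w, IsLongest b w := by
  have := finite_weylGroup b
  obtain ⟨w, hw⟩ := Finite.exists_max fun w : weylGroup b => length b w.1
  exact ⟨w.1, w.2, fun v hv => hw ⟨v, hv⟩⟩

/-- If `w α_i` were positive, exchange on a shortest word for `w s_i` would give a strictly shorter
word for `w`, against maximality. -/
theorem IsLongest.neg_mem_posRoots {w : M ≃ₗ[ℚ] M} (hw : IsLongest b w) (i : b.support) :
    -w (simpleRoot b i) ∈ posRoots b := by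
  have hs := mul_mem hw.1 (simpleReflection_mem_weylGroup b i)
  refine (neg_mem_posRoots_iff b (weylGroup_mem_range b hw.1 ⟨i, rfl⟩)).2 fun h => ?_
  obtain ⟨l, hl, hl'⟩ := exists_wordProd_length b hs
  obtain ⟨l', h1, h2⟩ := exists_wordProd_eq_mul b l i (by
    rw [hl', LinearEquiv.mul_apply, simpleReflection_simpleRoot, map_neg]
    exact neg_notMem_posRoots b h)
  have h3 := length_wordProd_le b l'
  rw [h2, hl', mul_assoc, simpleReflection_mul_self, mul_one] at h3
  have h4 := hw.2 _ hs
  omega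

theorem longestElement_eq {w : M ≃ₗ[ℚ] M} (hw : w ∈ weylGroup b)
    (h : ∀ i, -w (simpleRoot b i) ∈ posRoots b) : longestElement b = w :=
  have hl : IsLongest b (longestElement b) := Classical.epsilon_spec (exists_isLongest b)
  eq_of_neg_mem_posRoots b hl.1 hw hl.neg_mem_posRoots h

omit [Finite ι] in
theorem star_eq {i j : b.support} (h : longestElement b (simpleRoot b i) = -simpleRoot b j) :
    star b i = j := by
  have h1 : longestElement b (simpleRoot b i) = -simpleRoot b (star b i) :=
    Classical.epsilon_spec (p := fun j => longestElement b (simpleRoot b i) = -simpleRoot b j)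
      ⟨j, h⟩
  rw [h, neg_inj, simpleRoot_eq, simpleRoot_eq] at h1
  exact (b.toWeightBasis.injective h1).symm

end Longest

/-! ### Adapted words, the Coxeter element and the roots `γ_i` -/

section Coxeter

variable {ι M N : Type*} [Finite ι] [AddCommGroup M] [Module ℚ M] [AddCommGroup N] [Module ℚ N]
  {P : RootPairing ι ℚ M N} [P.IsCrystallographic] {b : P.Base}

namespace DynkinQuiver

theorem reflect_ξ_self (Q : DynkinQuiver b) (i : b.support) (hi : Q.IsSource i) :
    (Q.reflect i hi).ξ i = Q.ξ i - 2 := by simp [reflect]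

theorem reflect_ξ_of_ne (Q : DynkinQuiver b) {i j : b.support} (hi : Q.IsSource i) (h : j ≠ i) :
    (Q.reflect i hi).ξ j = Q.ξ j := by simp [reflect, h]

omit [Finite ι] [P.IsCrystallographic] in
@[ext] theorem ext {Q Q' : DynkinQuiver b} (h : ∀ i, Q.ξ i = Q'.ξ i) : Q = Q' := by
  cases Q
  cases Q'
  congr
  exact funext h

theorem exists_isAdapted (Q : DynkinQuiver b) : ∃ l : List b.support,
    l.Nodup ∧ (∀ i, i ∈ l) ∧ Q.IsAdapted l ∧ wordProd b l = Q.coxeterElement :=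
  Q.existsUnique_coxeterElement.choose_spec.1

theorem coxeterElement_eq {Q : DynkinQuiver b} {l : List b.support} (hl : l.Nodup)
    (hm : ∀ i, i ∈ l) (ha : Q.IsAdapted l) : Q.coxeterElement = wordProd b l :=
  (Q.existsUnique_coxeterElement.choose_spec.2 _ ⟨l, hl, hm, ha, rfl⟩).symm

theorem coxeterElement_mem_weylGroup (Q : DynkinQuiver b) : Q.coxeterElement ∈ weylGroup b := by
  obtain ⟨l, -, -, -, h⟩ := Q.exists_isAdapted
  exact h ▸ wordProd_mem_weylGroup b l

theorem exists_isAdapted_split (Q : DynkinQuiver b) (j : b.support) :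
    ∃ u v : List b.support, (u ++ j :: v).Nodup ∧ (∀ i, i ∈ u ++ j :: v) ∧
      Q.IsAdapted (u ++ j :: v) ∧
      Q.coxeterElement = wordProd b u * simpleReflection b j * wordProd b v := by
  obtain ⟨l, hl, hm, ha, h⟩ := Q.exists_isAdapted
  obtain ⟨u, v, rfl⟩ := List.append_of_mem (hm j)
  exact ⟨u, v, hl, hm, ha, by rw [← h, wordProd_append, wordProd_cons, mul_assoc]⟩

/-- Neither height has changed by the time `j` is reflected as a source. Order in an adapted word
thus records the arrows. -/
theorem IsAdapted.lt {u v : List b.support} {i j : b.support} {Q : DynkinQuiver b}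
    (h : Q.IsAdapted (u ++ j :: v)) (hj : j ∉ u) (hi : i ∉ u) (hij : Adj b j i) :
    Q.ξ i < Q.ξ j := by
  induction u generalizing Q with
  | nil => exact h.1 i hij
  | cons k u ih =>
    rw [List.mem_cons, not_or] at hj hi
    obtain ⟨hk, h⟩ := h
    have := ih h hj.2 hi.2
    rwa [reflect_ξ_of_ne _ _ hj.1, reflect_ξ_of_ne _ _ hi.1] at this

theorem IsAdapted.notMem_of_lt {u v : List b.support} {i j : b.support} {Q : DynkinQuiver b}
    (ha : Q.IsAdapted (u ++ j :: v)) (hn : (u ++ j :: v).Nodup) (h : Adj b j i)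
    (hξ : Q.ξ i < Q.ξ j) : i ∉ u := by
  intro hi
  obtain ⟨u1, u2, rfl⟩ := List.append_of_mem hi
  rw [List.append_assoc, List.cons_append] at ha hn
  have h1 : i ∉ u1 := fun e => (List.nodup_append.1 hn).2.2 i e i (by simp) rfl
  have h2 : j ∉ u1 := fun e => (List.nodup_append.1 hn).2.2 j e j (by simp) rfl
  exact lt_asymm hξ (ha.lt h1 h2 h.symm)

-- Running through `l` lowers each height by twice its multiplicity in `l`; the inequality says that
-- `i` is then a source.
open scoped Classical in
theorem IsAdapted.concat {l : List b.support} {i : b.support} {Q : DynkinQuiver b}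
    (h : Q.IsAdapted l)
    (hi : ∀ j, Adj b i j → Q.ξ j - 2 * l.count j < Q.ξ i - 2 * l.count i) :
    Q.IsAdapted (l ++ [i]) := by
  induction l generalizing Q with
  | nil => exact ⟨fun j hj => by simpa using hi j hj, trivial⟩
  | cons k l ih =>
    obtain ⟨hk, h⟩ := h
    refine ⟨hk, ih h fun j hj => ?_⟩
    have := hi j hj
    simp only [List.count_cons, reflect, beq_iff_eq, @eq_comm _ k] at this ⊢
    split_ifs at this ⊢ <;> push_cast at this <;> linarith

/-- A source can be moved to the front of an adapted word. After the other letters have each been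
used once, `i` is a source of the reflected quiver and can be appended at the end. -/
theorem exists_isAdapted_cons (Q : DynkinQuiver b) (i : b.support) (hi : Q.IsSource i) :
    ∃ l : List b.support, l.Nodup ∧ i ∉ l ∧ Q.coxeterElement = wordProd b (i :: l) ∧
      (Q.reflect i hi).coxeterElement = wordProd b (l ++ [i]) := by
  classical
  obtain ⟨u, v, hn, hm, ha, h⟩ := Q.exists_isAdapted_split i
  rw [List.nodup_middle, List.nodup_cons] at hn
  obtain ⟨h1, h2⟩ := isAdapted_move u v Q i hi (fun e => hn.1 (by simp [e])) ha
  refine ⟨u ++ v, hn.2, hn.1, ?_, ?_⟩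
  · rw [wordProd_cons, ← h2, h, wordProd_append, wordProd_cons, mul_assoc]
  · refine coxeterElement_eq ?_ ?_ (h1.concat ?_)
    · rw [List.nodup_append_comm]
      exact List.nodup_cons.2 hn
    · intro j
      have := hm j
      simp only [List.mem_append, List.mem_cons, List.not_mem_nil, or_false] at this ⊢
      tauto
    · intro j hj
      have hji : j ≠ i := by
        rintro rfl
        exact lt_irrefl _ (hi j hj)
      have hjm : j ∈ u ++ v := by
        have := hm j
        simp only [List.mem_append, List.mem_cons] at this ⊢
        tauto
      rw [List.count_eq_one_of_mem hn.2 hjm, List.count_eq_zero_of_not_mem hn.1,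
        reflect_ξ_self, reflect_ξ_of_ne _ _ hji]
      have := hi j hj
      push_cast
      linarith

theorem coxeterElement_reflect (Q : DynkinQuiver b) (i : b.support) (hi : Q.IsSource i) :
    (Q.reflect i hi).coxeterElement =
      simpleReflection b i * Q.coxeterElement * simpleReflection b i := by
  obtain ⟨l, -, -, h1, h2⟩ := Q.exists_isAdapted_cons i hi
  rw [h1, h2, wordProd_cons, wordProd_append, ← mul_assoc, simpleReflection_mul_self, one_mul,
    wordProd_cons, wordProd_nil, mul_one]

variable [P.IsRootSystem]

theorem coxeterElement_fundamentalWeight {Q : DynkinQuiver b} {i : b.support}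
    (hi : Q.IsSource i) : Q.coxeterElement (fundamentalWeight b i) =
      simpleReflection b i (fundamentalWeight b i) := by
  obtain ⟨l, -, h, h1, -⟩ := Q.exists_isAdapted_cons i hi
  rw [h1, wordProd_cons, LinearEquiv.mul_apply, wordProd_fundamentalWeight_of_notMem b h]

theorem γ_eq_simpleRoot {Q : DynkinQuiver b} {i : b.support} (hi : Q.IsSource i) :
    Q.γ i = simpleRoot b i := by
  rw [γ, coxeterElement_fundamentalWeight hi, simpleReflection_fundamentalWeight, sub_sub_cancel]

theorem eq_zero_of_coxeterElement_apply_eq (Q : DynkinQuiver b) {x : M}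
    (h : Q.coxeterElement x = x) : x = 0 := by
  obtain ⟨l, hl, hm, -, hw⟩ := Q.exists_isAdapted
  rw [← hw] at h
  exact eq_zero_of_copair b fun i => copair_eq_zero_of_wordProd b hl h i (hm i)

/-- Injectivity of `1 - τ_Q`, which pulls relations between the `γ_i` back to the fundamental
weights. -/
theorem eq_of_sub_coxeterElement (Q : DynkinQuiver b) {x y : M}
    (h : x - Q.coxeterElement x = y - Q.coxeterElement y) : x = y := by
  rw [← sub_eq_zero]
  refine Q.eq_zero_of_coxeterElement_apply_eq ?_
  rw [map_sub, sub_eq_sub_iff_add_eq_add]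
  rw [sub_eq_sub_iff_add_eq_add] at h
  rw [add_comm, ← h, add_comm]

/-- Both `u` and `v` fix `ϖ_j`, so only `s_j` contributes. -/
theorem γ_eq_wordProd {Q : DynkinQuiver b} {u v : List b.support} {j : b.support}
    (hn : (u ++ j :: v).Nodup)
    (h : Q.coxeterElement = wordProd b u * simpleReflection b j * wordProd b v) :
    Q.γ j = wordProd b u (simpleRoot b j) := by
  rw [List.nodup_middle, List.nodup_cons, List.mem_append, not_or] at hn
  rw [γ, h, LinearEquiv.mul_apply, LinearEquiv.mul_apply,
    wordProd_fundamentalWeight_of_notMem b hn.1.2, simpleReflection_fundamentalWeight, map_sub,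
    wordProd_fundamentalWeight_of_notMem b hn.1.1, sub_sub_cancel]

theorem γ_mem_posRoots (Q : DynkinQuiver b) (j : b.support) : Q.γ j ∈ posRoots b := by
  obtain ⟨u, v, hn, -, -, h⟩ := Q.exists_isAdapted_split j
  rw [γ_eq_wordProd hn h]
  rw [List.nodup_middle, List.nodup_cons, List.mem_append, not_or] at hn
  exact wordProd_simpleRoot_mem_posRoots b (List.nodup_append.1 hn.2).1 hn.1.1

/-- With `τ = u s_j v` and `γ_j = u α_j` one gets `τ⁻¹ γ_j = -v⁻¹ α_j`, and `v` has distinct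
letters, none equal to `j`. -/
theorem neg_coxeterElement_inv_γ_mem_posRoots (Q : DynkinQuiver b) (j : b.support) :
    -Q.coxeterElement⁻¹ (Q.γ j) ∈ posRoots b := by
  obtain ⟨u, v, hn, -, -, h⟩ := Q.exists_isAdapted_split j
  have h1 : Q.coxeterElement⁻¹ (Q.γ j) = -wordProd b v.reverse (simpleRoot b j) := by
    rw [γ_eq_wordProd hn h, ← LinearEquiv.mul_apply]
    have h2 : Q.coxeterElement⁻¹ * wordProd b u =
        wordProd b v.reverse * simpleReflection b j := by
      rw [h, wordProd_reverse, mul_inv_rev, mul_inv_rev, simpleReflection_inv]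
      group
    rw [h2, LinearEquiv.mul_apply, simpleReflection_simpleRoot, map_neg]
  rw [h1, neg_neg]
  rw [List.nodup_middle, List.nodup_cons, List.mem_append, not_or] at hn
  exact wordProd_simpleRoot_mem_posRoots b (List.nodup_reverse.2 (List.nodup_append.1 hn.2).2.1)
    (by simpa using hn.1.2)

theorem γ_injective (Q : DynkinQuiver b) : Function.Injective Q.γ := by
  classical
  intro i j h
  have h1 := congr_arg (copair b i) (Q.eq_of_sub_coxeterElement h)
  rw [copair_fundamentalWeight, copair_fundamentalWeight, if_pos rfl] at h1
  by_contra hij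
  rw [if_neg hij] at h1
  exact one_ne_zero h1

-- Undoing the letters one by one, the sign can change only at a letter whose simple root is the
-- current vector.
omit [P.IsCrystallographic] in
theorem exists_split_of_notMem_posRoots (l : List b.support) {x : M} (hx : x ∈ posRoots b)
    (h : (wordProd b l)⁻¹ x ∉ posRoots b) :
    ∃ u j v, l = u ++ j :: v ∧ x = wordProd b u (simpleRoot b j) := by
  induction l generalizing x with
  | nil => exact absurd hx h
  | cons i l ih =>
    by_cases hi : x = simpleRoot b i
    · exact ⟨[], i, l, rfl, hi⟩
    · obtain ⟨u, j, v, h1, h2⟩ := ih (simpleReflection_mem_posRoots b hx hi) (by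
        rwa [wordProd_cons, mul_inv_rev, simpleReflection_inv] at h)
      refine ⟨i :: u, j, v, by rw [h1]; rfl, ?_⟩
      rw [wordProd_cons, LinearEquiv.mul_apply, ← h2, simpleReflection_simpleReflection]

theorem exists_γ_eq (Q : DynkinQuiver b) {x : M} (hx : x ∈ posRoots b)
    (h : Q.coxeterElement⁻¹ x ∉ posRoots b) : ∃ j, Q.γ j = x := by
  obtain ⟨l, hl, -, -, hw⟩ := Q.exists_isAdapted
  rw [← hw] at h
  obtain ⟨u, j, v, rfl, h2⟩ := exists_split_of_notMem_posRoots l hx h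
  refine ⟨j, ?_⟩
  rw [h2]
  exact γ_eq_wordProd hl (by rw [← hw, wordProd_append, wordProd_cons, mul_assoc])

/-- Here `i` precedes `j` in an adapted word. With `coeff_γ_eq_zero`, this lets the support of `γ_j`
on the neighbours of `j` determine the arrows at `j`. -/
theorem coeff_γ_pos (Q : DynkinQuiver b) {i j : b.support} (h : Adj b j i)
    (hξ : Q.ξ j < Q.ξ i) : 0 < coeff b i (Q.γ j) := by
  obtain ⟨u, v, hn, -, ha, hw⟩ := Q.exists_isAdapted_split j
  rw [γ_eq_wordProd hn hw]
  rw [List.nodup_middle, List.nodup_cons, List.mem_append, not_or] at hn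
  refine (coeff_wordProd_simpleRoot b (List.nodup_append.1 hn.2).1 hn.1.1).2 i ?_ h
  by_contra hi
  exact lt_asymm hξ (ha.lt hn.1.1 hi h)

theorem coeff_γ_eq_zero (Q : DynkinQuiver b) {i j : b.support} (h : Adj b j i)
    (hξ : Q.ξ i < Q.ξ j) : coeff b i (Q.γ j) = 0 := by
  classical
  obtain ⟨u, v, hn, hm, ha, hw⟩ := Q.exists_isAdapted_split j
  have hij : j ≠ i := by
    rintro rfl
    exact lt_irrefl _ hξ
  have hi : i ∉ u := ha.notMem_of_lt hn h hξ
  rw [γ_eq_wordProd hn hw, coeff_wordProd_of_notMem b hi, coeff_simpleRoot, if_neg hij]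

/-- One has `τ γ_j = u s_j v u α_j` with `i` in `v`. The outer `u s_j` does not affect the
`i`-coefficient, and `v u` is a word with distinct letters containing `i`. -/
theorem coeff_coxeterElement_γ_pos (Q : DynkinQuiver b) {i j : b.support} (h : Adj b j i)
    (hξ : Q.ξ i < Q.ξ j) : 0 < coeff b i (Q.coxeterElement (Q.γ j)) := by
  obtain ⟨u, v, hn, hm, ha, hw⟩ := Q.exists_isAdapted_split j
  rw [γ_eq_wordProd hn hw]
  have hij : j ≠ i := by
    rintro rfl
    exact lt_irrefl _ hξ
  have hi : i ∉ u := ha.notMem_of_lt hn h hξ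
  rw [List.nodup_middle, List.nodup_cons] at hn
  have hv : i ∈ v := by
    have := hm i
    simp only [List.mem_append, List.mem_cons, hi, hij.symm, false_or] at this
    exact this
  rw [hw, LinearEquiv.mul_apply, LinearEquiv.mul_apply, coeff_wordProd_of_notMem b hi,
    coeff_simpleReflection_of_ne b hij, ← LinearEquiv.mul_apply, ← wordProd_append]
  refine (coeff_wordProd_simpleRoot b (List.nodup_append_comm.1 hn.2) ?_).2 i (by simp [hv]) h
  simpa [or_comm] using hn.1

/-- If the height function of `Q'` is `ξ - 2m` with `m ≥ 0`, then `Q'` is obtained from `Q` by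
source reflections, whose product `w` satisfies `w ϖ_i = τ_Q^{m_i} ϖ_i`. -/
theorem exists_weylGroup_of_le (m : b.support → ℕ) (Q Q' : DynkinQuiver b)
    (h : ∀ i, Q'.ξ i = Q.ξ i - 2 * m i) :
    ∃ w ∈ weylGroup b, Q'.coxeterElement = w⁻¹ * Q.coxeterElement * w ∧
      ∀ i, w (fundamentalWeight b i) = (Q.coxeterElement ^ m i) (fundamentalWeight b i) := by
  classical
  induction hs : ∑ i, m i generalizing m Q with
  | zero =>
    have hm : ∀ i, m i = 0 := by simpa using hs
    have : Q' = Q := ext fun i => by simp [h, hm]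
    refine ⟨1, one_mem _, by simp [this], fun i => by simp [hm]⟩
  | succ s ih =>
    have hne : (Finset.univ.filter fun i => m i ≠ 0).Nonempty := by
      by_contra hne
      simp only [Finset.not_nonempty_iff_eq_empty, Finset.filter_eq_empty_iff, not_not] at hne
      rw [Finset.sum_eq_zero fun i hi => hne hi] at hs
      omega
    -- A highest vertex still to be lowered is a source: a higher neighbour `j` would have `m j =
    -- 0`, and the final heights of `i` and `j` would differ by at least 3.
    obtain ⟨i, hi, hmax⟩ := Finset.exists_max_image _ Q.ξ hne
    simp only [Finset.mem_filter, Finset.mem_univ, true_and] at hi hmax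
    have hsrc : Q.IsSource i := by
      intro j hj
      have h1 := Q.height i j hj
      have h2 := Q'.height i j hj
      rw [h, h] at h2
      by_cases hmj : m j = 0
      · rw [hmj] at h2
        have : 0 < m i := Nat.pos_of_ne_zero hi
        grind
      · have := hmax j hmj
        grind
    set m' : b.support → ℕ := fun j => m j - if j = i then 1 else 0 with hm'
    have hi' : m' i + 1 = m i := by
      simp only [hm', if_true]
      omega
    have hj' : ∀ j, j ≠ i → m' j = m j := by
      intro j hj
      simp [hm', hj]
    obtain ⟨w, hw, h1, h2⟩ := ih m' (Q.reflect i hsrc) (by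
      intro j
      rcases eq_or_ne j i with rfl | hj
      · rw [h, reflect_ξ_self, ← hi']
        push_cast
        ring
      · rw [h, reflect_ξ_of_ne _ _ hj, hj' j hj]) (by
      have h1 : m i + ∑ x ∈ Finset.univ.erase i, m x = ∑ x, m x :=
        Finset.add_sum_erase _ m (Finset.mem_univ i)
      have h2 : m' i + ∑ x ∈ Finset.univ.erase i, m' x = ∑ x, m' x :=
        Finset.add_sum_erase _ m' (Finset.mem_univ i)
      have h3 : ∑ x ∈ Finset.univ.erase i, m' x = ∑ x ∈ Finset.univ.erase i, m x :=
        Finset.sum_congr rfl fun j hj => hj' j (Finset.ne_of_mem_erase hj)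
      omega)
    refine ⟨simpleReflection b i * w, mul_mem (simpleReflection_mem_weylGroup b i) hw, ?_, ?_⟩
    · rw [h1, coxeterElement_reflect, mul_inv_rev, simpleReflection_inv]
      group
    · intro j
      have h3 : simpleReflection b i * (Q.reflect i hsrc).coxeterElement ^ m' j =
          Q.coxeterElement ^ m' j * simpleReflection b i := by
        have h4 : SemiconjBy (simpleReflection b i) (Q.reflect i hsrc).coxeterElement
            Q.coxeterElement := by
          rw [SemiconjBy, coxeterElement_reflect, ← mul_assoc, ← mul_assoc,
            simpleReflection_mul_self, one_mul]
        exact (h4.pow_right _).eq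
      rw [LinearEquiv.mul_apply, h2, ← LinearEquiv.mul_apply, h3, LinearEquiv.mul_apply]
      -- For `j = i` the missing power of `τ_Q` comes from `s_i ϖ_i = τ_Q ϖ_i`; otherwise `s_i`
      -- fixes `ϖ_j`.
      rcases eq_or_ne j i with rfl | hj
      · rw [← hi', pow_succ, LinearEquiv.mul_apply, coxeterElement_fundamentalWeight hsrc]
      · rw [hj' j hj, simpleReflection_fundamentalWeight_of_ne b hj.symm]

end DynkinQuiver

end Coxeter

/-! ### Orbits on `Φ⁺ × ℤ` and bijectivity of `φ_Q` -/

theorem exists_forall_le_iff_le {f : ℤ → ℤ} (hf : ∀ k, f (k + 1) = f k ∨ f (k + 1) = f k - 1)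
    (hlt : ∀ k, ∃ j, f j < f k) (hgt : ∀ k, ∃ j, f k < f j) (u : ℤ) :
    ∃ K, ∀ j, K ≤ j ↔ f j ≤ u := by
  have hanti : Antitone f := antitone_int_of_succ_le fun k => by rcases hf k with h | h <;> omega
  have h1 : ∀ n : ℕ, ∃ j, f j ≤ f 0 - n := by
    intro n
    induction n with
    | zero => exact ⟨0, by simp⟩
    | succ n ih =>
      obtain ⟨j, hj⟩ := ih
      obtain ⟨k, hk⟩ := hlt j
      exact ⟨k, by push_cast; omega⟩
  have h2 : ∀ n : ℕ, ∃ j, f 0 + n ≤ f j := by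
    intro n
    induction n with
    | zero => exact ⟨0, by simp⟩
    | succ n ih =>
      obtain ⟨j, hj⟩ := ih
      obtain ⟨k, hk⟩ := hgt j
      exact ⟨k, by push_cast; omega⟩
  obtain ⟨j1, hj1⟩ := h1 (f 0 - u).toNat
  obtain ⟨j2, hj2⟩ := h2 (u + 1 - f 0).toNat
  obtain ⟨K, hK, hmin⟩ := Int.exists_least_of_bdd (P := fun j => f j ≤ u)
    ⟨j2, fun z hz => by
      by_contra h
      have := hanti (not_le.1 h).le
      omega⟩ ⟨j1, by omega⟩
  exact ⟨K, fun j => ⟨fun h => (hanti h).trans hK, fun h => hmin j h⟩⟩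

section Orbits

variable {ι M N : Type*} [Finite ι] [AddCommGroup M] [Module ℚ M] [AddCommGroup N] [Module ℚ N]
  {P : RootPairing ι ℚ M N} [P.IsRootSystem] {b : P.Base}

namespace DynkinQuiver

omit [Finite ι] in
theorem signedStep_mem {w : M ≃ₗ[ℚ] M} (hw : w ∈ weylGroup b) (ε : ℤ) {x : M × ℤ}
    (hx : x.1 ∈ posRoots b) : (signedStep b w ε x).1 ∈ posRoots b := by
  rw [signedStep]
  split_ifs with h
  · exact h
  · exact (neg_mem_posRoots_iff b (weylGroup_mem_range b hw hx.1)).2 h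

omit [Finite ι] in
theorem signedStep_inv_signedStep (w : M ≃ₗ[ℚ] M) (ε : ℤ) {x : M × ℤ}
    (hx : x.1 ∈ posRoots b) : signedStep b w⁻¹ (-ε) (signedStep b w ε x) = x := by
  have h1 : w⁻¹ (w x.1) = x.1 := w.symm_apply_apply x.1
  by_cases h : w x.1 ∈ posRoots b
  · rw [signedStep, signedStep, if_pos h]
    simp [h1, hx]
  · rw [signedStep, signedStep, if_neg h]
    simp [neg_notMem_posRoots b hx]

variable [P.IsCrystallographic]

/-- The permutation of `Φ⁺ × ℤ` that describes the passage from `φ_Q(i, p)` to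
`φ_Q(i, p - 2)`. -/
noncomputable def step (Q : DynkinQuiver b) : Equiv.Perm {x : M × ℤ // x.1 ∈ posRoots b} where
  toFun x := ⟨signedStep b Q.coxeterElement (-1) x.1,
    signedStep_mem Q.coxeterElement_mem_weylGroup _ x.2⟩
  invFun x := ⟨signedStep b Q.coxeterElement⁻¹ 1 x.1,
    signedStep_mem (inv_mem Q.coxeterElement_mem_weylGroup) _ x.2⟩
  left_inv x := Subtype.ext (signedStep_inv_signedStep Q.coxeterElement (-1) x.2)
  right_inv x := Subtype.ext (by
    simpa using signedStep_inv_signedStep Q.coxeterElement⁻¹ 1 x.2)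

/-- The translation of `Φ⁺ × ℤ` by `c`. -/
def shift (b : P.Base) (c : ℤ) : Equiv.Perm {x : M × ℤ // x.1 ∈ posRoots b} where
  toFun x := ⟨(x.1.1, x.1.2 + c), x.2⟩
  invFun x := ⟨(x.1.1, x.1.2 - c), x.2⟩
  left_inv x := by simp
  right_inv x := by simp

theorem commute_step_shift (Q : DynkinQuiver b) (c : ℤ) : Commute Q.step (shift b c) := by
  ext x
  · simp only [Equiv.Perm.mul_apply, step, shift, Equiv.coe_fn_mk, signedStep]
    split_ifs <;> rfl
  · simp only [Equiv.Perm.mul_apply, step, shift, Equiv.coe_fn_mk, signedStep]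
    split_ifs
    · rfl
    · dsimp only
      ring

/-- The element `(γ_i, u)` of `Φ⁺ × ℤ`. -/
noncomputable def base (Q : DynkinQuiver b) (i : b.support) (u : ℤ) :
    {x : M × ℤ // x.1 ∈ posRoots b} := ⟨(Q.γ i, u), Q.γ_mem_posRoots i⟩

theorem shift_base (Q : DynkinQuiver b) (i : b.support) (u c : ℤ) :
    shift b c (Q.base i u) = Q.base i (u + c) := rfl

theorem base_inj (Q : DynkinQuiver b) {i j : b.support} {u v : ℤ}
    (h : Q.base i u = Q.base j v) : i = j ∧ u = v := by
  have h1 := congr_arg Subtype.val h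
  exact ⟨Q.γ_injective (congr_arg Prod.fst h1), congr_arg Prod.snd h1⟩

theorem φAux_eq (Q : DynkinQuiver b) (i : b.support) (k : ℤ) :
    Q.φAux i k = ((Q.step ^ k) (Q.base i 0)).1 := by
  cases k with
  | ofNat n =>
    rw [Int.ofNat_eq_natCast, zpow_natCast]
    change (signedStep b Q.coxeterElement (-1))^[n] (Q.γ i, 0) = _
    induction n with
    | zero => rfl
    | succ n ih =>
      rw [Function.iterate_succ_apply', ih, pow_succ', Equiv.Perm.mul_apply]
      rfl
  | negSucc n =>
    rw [zpow_negSucc, ← inv_pow]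
    change (signedStep b Q.coxeterElement⁻¹ 1)^[n + 1] (Q.γ i, 0) = _
    induction n + 1 with
    | zero => rfl
    | succ n ih =>
      rw [Function.iterate_succ_apply', ih, pow_succ', Equiv.Perm.mul_apply]
      rfl

theorem step_eq_or (Q : DynkinQuiver b) (x : {x : M × ℤ // x.1 ∈ posRoots b}) :
    (Q.step x).1 = (Q.coxeterElement x.1.1, x.1.2) ∨
      (Q.step x).1 = (-Q.coxeterElement x.1.1, x.1.2 - 1) := by
  change signedStep _ _ _ _ = _ ∨ signedStep _ _ _ _ = _
  rw [signedStep]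
  split_ifs
  · exact Or.inl rfl
  · exact Or.inr rfl

/-- A drop means that the new root is made negative by `τ⁻¹`, and the `γ_i` are exactly such
positive roots. -/
theorem snd_step_eq_iff (Q : DynkinQuiver b) (x : {x : M × ℤ // x.1 ∈ posRoots b}) :
    (Q.step x).1.2 = x.1.2 - 1 ↔ ∃ i, (Q.step x).1.1 = Q.γ i := by
  have h1 : Q.coxeterElement⁻¹ (Q.coxeterElement x.1.1) = x.1.1 :=
    Q.coxeterElement.symm_apply_apply x.1.1
  have hx := (Q.step x).2
  rcases Q.step_eq_or x with h | h
  · rw [h]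
    refine iff_of_false (by dsimp only; omega) ?_
    rintro ⟨i, hi⟩
    have h2 := Q.neg_coxeterElement_inv_γ_mem_posRoots i
    rw [← hi, h1] at h2
    exact neg_notMem_posRoots b x.2 h2
  · rw [h] at hx ⊢
    refine iff_of_true rfl ?_
    obtain ⟨j, hj⟩ := Q.exists_γ_eq hx (by
      rw [map_neg, h1]
      exact neg_notMem_posRoots b x.2)
    exact ⟨j, hj.symm⟩

theorem zpow_succ_apply' {G : Type*} (f : Equiv.Perm G) (k : ℤ) (x : G) :
    (f ^ (k + 1)) x = f ((f ^ k) x) := by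
  rw [add_comm, zpow_one_add, Equiv.Perm.mul_apply]

theorem snd_zpow_succ (Q : DynkinQuiver b) (x : {x : M × ℤ // x.1 ∈ posRoots b}) (k : ℤ) :
    ((Q.step ^ (k + 1)) x).1.2 = ((Q.step ^ k) x).1.2 ∨
      ((Q.step ^ (k + 1)) x).1.2 = ((Q.step ^ k) x).1.2 - 1 := by
  rw [zpow_succ_apply']
  exact (Q.step_eq_or ((Q.step ^ k) x)).imp (fun h => by rw [h]) fun h => by rw [h]

/-- Every sign change costs one level, so the parity of the level change recovers the sign lost in
`Φ⁺`. -/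
theorem fst_zpow (Q : DynkinQuiver b) (x : {x : M × ℤ // x.1 ∈ posRoots b}) (k : ℤ) :
    (Q.coxeterElement ^ k) x.1.1 =
      (((Q.step ^ k) x).1.2 - x.1.2).negOnePow • ((Q.step ^ k) x).1.1 := by
  have key : ∀ k : ℤ, (Q.coxeterElement ^ k) x.1.1 =
      (((Q.step ^ k) x).1.2 - x.1.2).negOnePow • ((Q.step ^ k) x).1.1 ↔
      (Q.coxeterElement ^ (k + 1)) x.1.1 =
      (((Q.step ^ (k + 1)) x).1.2 - x.1.2).negOnePow • ((Q.step ^ (k + 1)) x).1.1 := by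
    intro k
    rw [zpow_succ_apply', add_comm k, zpow_one_add, LinearEquiv.mul_apply]
    set y := (Q.step ^ k) x
    have h2 : ∀ (c : ℤˣ) (z : M), Q.coxeterElement (c • z) = c • Q.coxeterElement z := by
      intro c z
      rw [Units.smul_def, Units.smul_def, map_zsmul]
    rw [← Q.coxeterElement.injective.eq_iff, h2]
    rcases Q.step_eq_or y with h | h
    · rw [h]
    · rw [h]
      dsimp only
      rw [show y.1.2 - 1 - x.1.2 = y.1.2 - x.1.2 - 1 by ring, Int.negOnePow_sub _ 1,
        Int.negOnePow_one, mul_neg, mul_one, smul_neg, Units.smul_def,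
          Units.smul_def, Units.val_neg, neg_smul, neg_neg]
  induction k with
  | zero => simp
  | succ n ih => exact (key _).1 ih
  | pred n ih => exact (key _).2 (by simpa using ih)

theorem isOfFinOrder_coxeterElement (Q : DynkinQuiver b) : IsOfFinOrder Q.coxeterElement := by
  have := finite_weylGroup b
  have h := isOfFinOrder_of_finite (⟨_, Q.coxeterElement_mem_weylGroup⟩ : weylGroup b)
  exact (weylGroup b).subtype.isOfFinOrder h

/-- The sum of `τ^n x` over a period is fixed by `τ`, hence zero, which is impossible if all terms
are positive roots. -/
theorem exists_pow_notMem_posRoots (Q : DynkinQuiver b) {x : M} (hx : x ∈ posRoots b) :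
    ∃ n : ℕ, (Q.coxeterElement ^ n) x ∉ posRoots b := by
  by_contra! h
  obtain ⟨i, hi⟩ := exists_coeff_pos b hx
  have h1 : ∑ n ∈ Finset.range (orderOf Q.coxeterElement), (Q.coxeterElement ^ n) x = 0 := by
    refine Q.eq_zero_of_coxeterElement_apply_eq ?_
    rw [map_sum]
    have h2 := Finset.sum_range_succ' (fun n => (Q.coxeterElement ^ n) x)
      (orderOf Q.coxeterElement)
    rw [Finset.sum_range_succ, pow_orderOf_eq_one, pow_zero, add_right_cancel_iff] at h2
    rw [h2]
    simp_rw [pow_succ', LinearEquiv.mul_apply]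
  have h2 := congr_arg (coeff b i) h1
  rw [map_sum, map_zero, Finset.sum_eq_zero_iff_of_nonneg fun n _ => coeff_nonneg b (h n) i] at h2
  have h3 := h2 0 (Finset.mem_range.2 (orderOf_pos_iff.2 Q.isOfFinOrder_coxeterElement))
  rw [pow_zero] at h3
  exact hi.ne' h3

theorem exists_inv_pow_notMem_posRoots (Q : DynkinQuiver b) {x : M} (hx : x ∈ posRoots b) :
    ∃ n : ℕ, (Q.coxeterElement⁻¹ ^ n) x ∉ posRoots b := by
  obtain ⟨n, hn⟩ := Q.exists_pow_notMem_posRoots hx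
  obtain ⟨N, hN⟩ := Nat.exists_eq_add_one_of_ne_zero
    (orderOf_pos_iff.2 Q.isOfFinOrder_coxeterElement).ne'
  refine ⟨N * n, ?_⟩
  have h1 : Q.coxeterElement⁻¹ ^ N = Q.coxeterElement := by
    have h2 := pow_orderOf_eq_one Q.coxeterElement
    rw [hN, pow_succ] at h2
    rw [inv_pow, inv_eq_of_mul_eq_one_right h2]
  rwa [pow_mul, h1]

theorem snd_zpow_ne (Q : DynkinQuiver b) (x : {x : M × ℤ // x.1 ∈ posRoots b}) {k : ℤ}
    (h : (Q.coxeterElement ^ k) x.1.1 ∉ posRoots b) : ((Q.step ^ k) x).1.2 ≠ x.1.2 := by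
  intro h1
  rw [fst_zpow, h1, sub_self, Int.negOnePow_zero, one_smul] at h
  exact h ((Q.step ^ k) x).2

theorem antitone_snd (Q : DynkinQuiver b) (x : {x : M × ℤ // x.1 ∈ posRoots b}) :
    Antitone fun k : ℤ => ((Q.step ^ k) x).1.2 :=
  antitone_int_of_succ_le fun k => by rcases Q.snd_zpow_succ x k with h | h <;> omega

theorem exists_le_iff_snd_le (Q : DynkinQuiver b) (x : {x : M × ℤ // x.1 ∈ posRoots b}) (u : ℤ) :
    ∃ K : ℤ, ∀ j : ℤ, K ≤ j ↔ ((Q.step ^ j) x).1.2 ≤ u := by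
  refine exists_forall_le_iff_le (Q.snd_zpow_succ x) (fun k => ?_) (fun k => ?_) u
  · obtain ⟨n, hn⟩ := Q.exists_pow_notMem_posRoots ((Q.step ^ k) x).2
    rw [← zpow_natCast] at hn
    have h1 := Q.snd_zpow_ne _ hn
    have h2 := Q.antitone_snd ((Q.step ^ k) x) (Int.natCast_nonneg n)
    refine ⟨n + k, ?_⟩
    rw [zpow_add, Equiv.Perm.mul_apply]
    exact lt_of_le_of_ne h2 h1
  · obtain ⟨n, hn⟩ := Q.exists_inv_pow_notMem_posRoots ((Q.step ^ k) x).2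
    rw [← zpow_natCast, inv_zpow'] at hn
    have h1 := Q.snd_zpow_ne _ hn
    have h2 := Q.antitone_snd ((Q.step ^ k) x) (neg_nonpos.2 (Int.natCast_nonneg n))
    refine ⟨-n + k, ?_⟩
    rw [zpow_add, Equiv.Perm.mul_apply]
    exact lt_of_le_of_ne h2 h1.symm

/-- Levels fall by at most one per step, so the first time at level at most `u` is a drop from `u +
1` to `u`, and a drop lands on some `γ_i`. -/
theorem exists_zpow_eq_base (Q : DynkinQuiver b) (x : {x : M × ℤ // x.1 ∈ posRoots b}) (u : ℤ) :
    ∃ (K : ℤ) (i : b.support), (Q.step ^ K) x = Q.base i u ∧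
      ∀ j : ℤ, K ≤ j ↔ ((Q.step ^ j) x).1.2 ≤ u := by
  obtain ⟨K, hK⟩ := Q.exists_le_iff_snd_le x u
  have h1 := (hK K).1 le_rfl
  have h2 := mt (hK (K - 1)).2 (by omega)
  have h3 := Q.snd_zpow_succ x (K - 1)
  have h4 : Q.step ((Q.step ^ (K - 1)) x) = (Q.step ^ K) x := by
    rw [← zpow_succ_apply', sub_add_cancel]
  obtain ⟨i, hi⟩ := (Q.snd_step_eq_iff ((Q.step ^ (K - 1)) x)).1 (by
    rw [h4]
    rw [sub_add_cancel] at h3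
    omega)
  rw [h4] at hi
  rw [sub_add_cancel] at h3
  exact ⟨K, i, Subtype.ext (Prod.ext hi (show _ = u by omega)), hK⟩

/-- The point `(γ_i, u)` can only be reached by a drop, so it is the first point of its orbit at
level `u`. This gives uniqueness of the entry point. -/
theorem le_iff_of_zpow_eq_base (Q : DynkinQuiver b) {x : {x : M × ℤ // x.1 ∈ posRoots b}}
    {u K : ℤ} {i : b.support} (h : (Q.step ^ K) x = Q.base i u) (j : ℤ) :
    K ≤ j ↔ ((Q.step ^ j) x).1.2 ≤ u := by
  obtain ⟨L, -, -, hL⟩ := Q.exists_zpow_eq_base x u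
  have h4 : Q.step ((Q.step ^ (K - 1)) x) = Q.base i u := by
    rw [← zpow_succ_apply', sub_add_cancel, h]
  have h1 := (Q.snd_step_eq_iff ((Q.step ^ (K - 1)) x)).2 ⟨i, by rw [h4]; rfl⟩
  rw [h4] at h1
  change u = _ at h1
  have h2 := mt (hL (K - 1)).1 (by omega)
  have h3 := (hL K).2 (by rw [h]; exact le_rfl)
  rw [show K = L by omega]
  exact hL j

theorem eq_of_zpow_eq_base (Q : DynkinQuiver b) {i j : b.support} {u k : ℤ}
    (h : (Q.step ^ k) (Q.base i u) = Q.base j u) : k = 0 ∧ i = j := by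
  have h1 := (Q.le_iff_of_zpow_eq_base h 0).2 le_rfl
  have h2 := (Q.le_iff_of_zpow_eq_base (K := 0) (x := Q.base i u) rfl k).2 (by rw [h]; exact le_rfl)
  obtain rfl : k = 0 := by omega
  exact ⟨rfl, (Q.base_inj h).1⟩

theorem eq_of_zpow_eq_zpow (Q : DynkinQuiver b) {i j : b.support} {u k l : ℤ}
    (h : (Q.step ^ k) (Q.base i u) = (Q.step ^ l) (Q.base j u)) : k = l ∧ i = j := by
  have h1 : (Q.step ^ (k - l)) (Q.base i u) = Q.base j u := by
    rw [sub_eq_neg_add, zpow_add, Equiv.Perm.mul_apply, h, ← Equiv.Perm.mul_apply, ← zpow_add,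
      neg_add_cancel, zpow_zero, Equiv.Perm.one_apply]
  obtain ⟨h2, h3⟩ := Q.eq_of_zpow_eq_base h1
  exact ⟨by omega, h3⟩

theorem exists_eq_zpow (Q : DynkinQuiver b) (x : {x : M × ℤ // x.1 ∈ posRoots b}) :
    ∃ (i : b.support) (k : ℤ), x = (Q.step ^ k) (Q.base i 0) := by
  obtain ⟨K, i, h, -⟩ := Q.exists_zpow_eq_base x 0
  refine ⟨i, -K, ?_⟩
  rw [← h, ← Equiv.Perm.mul_apply, ← zpow_add, neg_add_cancel, zpow_zero, Equiv.Perm.one_apply]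

theorem bijOn_φ (Q : DynkinQuiver b) :
    Set.BijOn Q.φ Q.repVertices (posRoots b ×ˢ (Set.univ : Set ℤ)) := by
  refine ⟨fun x _ => ?_, ?_, ?_⟩
  · rw [φ, φAux_eq]
    exact ⟨((Q.step ^ _) _).2, trivial⟩
  · rintro ⟨i, p⟩ hp ⟨j, q⟩ hq h
    rw [φ, φ, φAux_eq, φAux_eq] at h
    obtain ⟨h1, rfl⟩ := Q.eq_of_zpow_eq_zpow (Subtype.ext h)
    obtain ⟨r, hr⟩ : Even (p - Q.ξ i) := hp
    obtain ⟨s, hs⟩ : Even (q - Q.ξ i) := hq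
    dsimp only at h1
    rw [Prod.mk.injEq]
    exact ⟨rfl, by omega⟩
  · rintro x ⟨hx, -⟩
    obtain ⟨i, k, h⟩ := Q.exists_eq_zpow ⟨x, hx⟩
    refine ⟨(i, Q.ξ i - 2 * k), ⟨-k, by dsimp only; ring⟩, ?_⟩
    rw [φ, φAux_eq]
    dsimp only
    rw [show (Q.ξ i - (Q.ξ i - 2 * k)) / 2 = k by omega, ← h]

end DynkinQuiver

end Orbits

/-! ### The window at level `0`, its lower boundary and `w₀` -/

section Nakayama

variable {ι M N : Type*} [Finite ι] [AddCommGroup M] [Module ℚ M] [AddCommGroup N] [Module ℚ N]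
  {P : RootPairing ι ℚ M N} [P.IsRootSystem] [P.IsCrystallographic] {b : P.Base}

namespace DynkinQuiver

/-- `κ` and `m` describe the vertices of the repetition quiver at which the second component of
`φ_Q` drops from `0` to `-1`: one has `φ_Q(i, ξ_i - 2m_i) = (γ_{κ i}, -1)`. -/
def IsNakayama (Q : DynkinQuiver b) (κ : b.support → b.support) (m : b.support → ℕ) : Prop :=
  ∀ i, (Q.step ^ (m i : ℤ)) (Q.base i 0) = Q.base (κ i) (-1)

theorem exists_isNakayama (Q : DynkinQuiver b) : ∃ κ m, Q.IsNakayama κ m := by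
  choose K κ h hK using fun i => Q.exists_zpow_eq_base (Q.base i 0) (-1)
  refine ⟨κ, fun i => (K i).toNat, fun i => ?_⟩
  have : ¬ K i ≤ 0 := mt (hK i 0).1 (by simp [base])
  rw [Int.toNat_of_nonneg (by omega), h]

namespace IsNakayama

variable {Q : DynkinQuiver b} {κ : b.support → b.support} {m : b.support → ℕ}

theorem le_iff (hQ : Q.IsNakayama κ m) (i : b.support) (k : ℤ) :
    m i ≤ k ↔ ((Q.step ^ k) (Q.base i 0)).1.2 ≤ -1 :=
  Q.le_iff_of_zpow_eq_base (hQ i) k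

theorem pos (hQ : Q.IsNakayama κ m) (i : b.support) : 0 < m i := by
  have : ¬ (m i : ℤ) ≤ 0 := mt (hQ.le_iff i 0).1 (by simp [base])
  omega

theorem snd_eq_zero_iff (hQ : Q.IsNakayama κ m) (i : b.support) (k : ℤ) :
    ((Q.step ^ k) (Q.base i 0)).1.2 = 0 ↔ 0 ≤ k ∧ k < m i := by
  have h1 := hQ.le_iff i k
  have h2 := Q.le_iff_of_zpow_eq_base (x := Q.base i 0) (K := 0) rfl k
  rw [h2, ← not_le, h1]
  omega

theorem injective (hQ : Q.IsNakayama κ m) : Function.Injective κ := by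
  intro i j h
  have h1 := hQ i
  rw [h, ← hQ j] at h1
  exact (Q.eq_of_zpow_eq_zpow h1).2

/-- One drop gives `τ^{m_i} γ_i = -γ_{κ i}`; then cancel `1 - τ`, which commutes with powers of `τ`.
-/
theorem pow_fundamentalWeight (hQ : Q.IsNakayama κ m) (i : b.support) :
    (Q.coxeterElement ^ m i) (fundamentalWeight b i) = -fundamentalWeight b (κ i) := by
  have h := Q.fst_zpow (Q.base i 0) (m i)
  rw [hQ i, zpow_natCast] at h
  have h1 : (Q.coxeterElement ^ m i) (Q.γ i) = -Q.γ (κ i) := by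
    refine h.trans ?_
    have : ((Q.base (κ i) (-1)).1.2 - (Q.base i 0).1.2).negOnePow = -1 := by
      simp [base, Int.negOnePow_neg]
    rw [this, Units.smul_def, Units.val_neg, Units.val_one, neg_smul, one_smul]
    rfl
  refine Q.eq_of_sub_coxeterElement ?_
  rw [← LinearEquiv.mul_apply, ← pow_succ', pow_succ, LinearEquiv.mul_apply, ← map_sub]
  refine h1.trans ?_
  rw [γ, map_neg]
  abel

/-- If it failed, `τ^{m_i + e} γ_j` would still be a positive root for a suitable `e`. But `τ^e γ_j`
has positive `i`-coefficient, and `τ^{m_i} ϖ_i = -ϖ_{κ i}` turns this into a negative `κ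
i`-coefficient. -/
theorem sub_le (hQ : Q.IsNakayama κ m) {i j : b.support} (hij : Adj b i j) :
    Q.ξ i - 2 * m i ≤ Q.ξ j - 2 * m j + 1 := by
  by_contra! hlt
  -- The exponent `e` is 0 or 1 according to the direction of the arrow between `i` and `j`.
  have key : ∀ e : ℕ, 2 * (e : ℤ) = Q.ξ j - Q.ξ i + 1 →
      0 < coeff b i ((Q.coxeterElement ^ e) (Q.γ j)) → False := by
    intro e he hpos
    have h1 : ((Q.step ^ ((m i + e : ℕ) : ℤ)) (Q.base j 0)).1.2 = 0 := by
      rw [hQ.snd_eq_zero_iff]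
      omega
    have h2 := Q.fst_zpow (Q.base j 0) ((m i + e : ℕ) : ℤ)
    rw [h1, zpow_natCast] at h2
    have h3 : (Q.coxeterElement ^ (m i + e)) (Q.γ j) =
        ((Q.step ^ ((m i + e : ℕ) : ℤ)) (Q.base j 0)).1.1 :=
      h2.trans (by simp [base])
    have h4 := coeff_nonneg b ((Q.step ^ ((m i + e : ℕ) : ℤ)) (Q.base j 0)).2 (κ i)
    rw [← h3] at h4
    obtain ⟨c, hc, h5⟩ := exists_coeff_inv_eq b (pow_mem Q.coxeterElement_mem_weylGroup (m i))
      (hQ.pow_fundamentalWeight i)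
    have h6 := h5 ((Q.coxeterElement ^ (m i + e)) (Q.γ j))
    rw [← LinearEquiv.mul_apply, pow_add, inv_mul_cancel_left, ← pow_add] at h6
    have := mul_nonneg hc.le h4
    linarith
  rcases (abs_eq zero_le_one).1 (Q.height i j hij) with h | h
  · exact key 0 (by push_cast; omega) (Q.coeff_γ_pos hij.symm (by omega))
  · refine key 1 (by push_cast; omega) ?_
    rw [pow_one]
    exact Q.coeff_coxeterElement_γ_pos hij.symm (by omega)

/-- The Dynkin quiver with height function `ξ - 2m`. -/
def lower (hQ : Q.IsNakayama κ m) : DynkinQuiver b where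
  ξ i := Q.ξ i - 2 * m i
  height i j hij := by
    -- The two inequalities bound the difference by 1 in absolute value, and it is odd because
    -- heights were lowered by even amounts.
    have h1 := hQ.sub_le hij
    have h2 := hQ.sub_le hij.symm
    have h3 := (abs_eq zero_le_one).1 (Q.height i j hij)
    rw [abs_eq zero_le_one]
    omega

theorem exists_weylGroup (hQ : Q.IsNakayama κ m) : ∃ w ∈ weylGroup b,
    hQ.lower.coxeterElement = w⁻¹ * Q.coxeterElement * w ∧
      ∀ i, w (fundamentalWeight b i) = -fundamentalWeight b (κ i) := by
  obtain ⟨w, hw, h1, h2⟩ := exists_weylGroup_of_le m Q hQ.lower fun i => rfl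
  exact ⟨w, hw, h1, fun i => (h2 i).trans (hQ.pow_fundamentalWeight i)⟩

/-- By `exists_coeff_inv_eq`, the root `-w⁻¹ α_{κ i}` has a positive `i`-coefficient and no other,
so it is `α_i`. -/
theorem apply_simpleRoot (hQ : Q.IsNakayama κ m) {w : M ≃ₗ[ℚ] M} (hw : w ∈ weylGroup b)
    (h : ∀ i, w (fundamentalWeight b i) = -fundamentalWeight b (κ i)) (i : b.support) :
    w (simpleRoot b i) = -simpleRoot b (κ i) := by
  classical
  have hc : ∀ j, ∃ c : ℚ, 0 < c ∧
      coeff b j (-w⁻¹ (simpleRoot b (κ i))) = if i = j then c else 0 := by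
    intro j
    obtain ⟨c, hc, h1⟩ := exists_coeff_inv_eq b hw (h j)
    refine ⟨c, hc, ?_⟩
    rw [map_neg, h1, neg_neg, coeff_simpleRoot]
    simp [hQ.injective.eq_iff]
  have hr : -w⁻¹ (simpleRoot b (κ i)) ∈ Set.range P.root :=
    P.neg_mem_range_root_iff.2 (weylGroup_mem_range b (inv_mem hw) ⟨κ i, rfl⟩)
  have h1 : -w⁻¹ (simpleRoot b (κ i)) = simpleRoot b i := by
    refine eq_simpleRoot_of_coeff b ((mem_posRoots_iff b hr).2 fun j => ?_) fun j hj => ?_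
    · obtain ⟨c, hc, h1⟩ := hc j
      rw [h1]
      split_ifs
      · exact hc.le
      · exact le_rfl
    · obtain ⟨c, hc, h1⟩ := hc j
      rw [h1, if_neg hj.symm]
  have h2 : w (w⁻¹ (simpleRoot b (κ i))) = simpleRoot b (κ i) := w.apply_symm_apply _
  rw [← h1, map_neg, h2]

theorem longestElement_eq (hQ : Q.IsNakayama κ m) {w : M ≃ₗ[ℚ] M} (hw : w ∈ weylGroup b)
    (h : ∀ i, w (fundamentalWeight b i) = -fundamentalWeight b (κ i)) :
    longestElement b = w :=
  DynkinRep.longestElement_eq b hw fun i => by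
    rw [hQ.apply_simpleRoot hw h, neg_neg]
    exact simpleRoot_mem_posRoots b _

theorem star_eq (hQ : Q.IsNakayama κ m) : star b = κ := by
  obtain ⟨w, hw, -, h⟩ := hQ.exists_weylGroup
  funext i
  refine DynkinRep.star_eq b ?_
  rw [hQ.longestElement_eq hw h, hQ.apply_simpleRoot hw h]

theorem involutive (hQ : Q.IsNakayama κ m) : Function.Involutive κ := by
  obtain ⟨w, hw, -, h⟩ := hQ.exists_weylGroup
  have hs := (Finite.injective_iff_surjective (f := κ)).1 hQ.injective
  have h1 := hQ.apply_simpleRoot hw h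
  have h2 : w = w⁻¹ := by
    refine eq_of_neg_mem_posRoots b hw (inv_mem hw) (fun i => ?_) fun i => ?_
    · rw [h1, neg_neg]
      exact simpleRoot_mem_posRoots b _
    · obtain ⟨j, rfl⟩ := hs i
      have h3 : w⁻¹ (w (simpleRoot b j)) = simpleRoot b j := w.symm_apply_apply _
      rw [← map_neg, ← h1, h3]
      exact simpleRoot_mem_posRoots b _
  intro i
  have h3 : w (w (simpleRoot b i)) = simpleRoot b i := by
    nth_rewrite 1 [h2]
    exact w.symm_apply_apply _
  rw [h1, map_neg, h1, neg_neg, simpleRoot_eq, simpleRoot_eq] at h3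
  exact b.toWeightBasis.injective h3

/-- The roots `γ_j` of the lowered quiver are `-w⁻¹ γ_{κ j}`, so comparing coefficients shows that
`ξ - 2m` and `ξ ∘ κ` orient the edge the same way. Both differences along it are ±1, hence equal. -/
theorem sub_eq_sub (hQ : Q.IsNakayama κ m) {i j : b.support} (hij : Adj b i j) :
    Q.ξ i - 2 * m i - Q.ξ (κ i) = Q.ξ j - 2 * m j - Q.ξ (κ j) := by
  obtain ⟨w, hw, h1, h2⟩ := hQ.exists_weylGroup
  have h3 := hQ.apply_simpleRoot hw h2
  have hκ : Adj b (κ i) (κ j) := hij.of_apply_eq_neg hw (h3 i) (h3 j)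
  have h4 : hQ.lower.γ j = -w⁻¹ (Q.γ (κ j)) := by
    have h5 : w⁻¹ (fundamentalWeight b (κ j)) = -fundamentalWeight b j := by
      have h6 : w⁻¹ (w (fundamentalWeight b j)) = fundamentalWeight b j := w.symm_apply_apply _
      rw [h2, map_neg] at h6
      rw [← h6, neg_neg]
    rw [γ, γ, h1, LinearEquiv.mul_apply, LinearEquiv.mul_apply, h2, map_neg, map_neg, map_sub, h5]
    abel
  obtain ⟨c, hc, h5⟩ := exists_coeff_inv_eq b hw (h2 i)
  have h6 : coeff b i (hQ.lower.γ j) = c * coeff b (κ i) (Q.γ (κ j)) := by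
    rw [h4, map_neg, h5, neg_neg]
  have h7 : hQ.lower.ξ j < hQ.lower.ξ i ↔ Q.ξ (κ j) < Q.ξ (κ i) := by
    constructor
    · intro h
      by_contra h'
      have h8 := hQ.lower.coeff_γ_pos hij.symm h
      have h9 := (abs_eq zero_le_one).1 (Q.height _ _ hκ)
      rw [h6, Q.coeff_γ_eq_zero hκ.symm (by omega), mul_zero] at h8
      exact lt_irrefl _ h8
    · intro h
      by_contra h'
      have h8 := mul_pos hc (Q.coeff_γ_pos hκ.symm h)
      have h9 := (abs_eq zero_le_one).1 (hQ.lower.height _ _ hij)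
      rw [← h6, hQ.lower.coeff_γ_eq_zero hij.symm (by omega)] at h8
      exact lt_irrefl _ h8
  have h8 := (abs_eq zero_le_one).1 (Q.height _ _ hκ)
  have h9 := (abs_eq zero_le_one).1 (hQ.lower.height _ _ hij)
  simp only [lower] at h7 h9
  omega

/-- The orbits partition `Φ⁺ × {0}`, and the orbit of vertex `i` meets it in `m i` points. -/
theorem sum_eq_ncard (hQ : Q.IsNakayama κ m) : ∑ i, m i = (posRoots b).ncard := by
  have hmem : ∀ x : (Σ i : b.support, Fin (m i)),
      ((Q.step ^ ((x.2 : ℕ) : ℤ)) (Q.base x.1 0)).1.2 = 0 := fun x => by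
    rw [hQ.snd_eq_zero_iff]
    have := x.2.2
    omega
  let f : (Σ i : b.support, Fin (m i)) → posRoots b := fun x =>
    ⟨((Q.step ^ ((x.2 : ℕ) : ℤ)) (Q.base x.1 0)).1.1, ((Q.step ^ _) _).2⟩
  have hf : Function.Bijective f := by
    constructor
    · intro x y h
      have h1 := Q.eq_of_zpow_eq_zpow (Subtype.ext (Prod.ext (congr_arg Subtype.val h)
        ((hmem x).trans (hmem y).symm)))
      obtain ⟨i, k⟩ := x
      obtain ⟨j, l⟩ := y
      obtain ⟨h2, rfl : i = j⟩ := h1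
      obtain rfl : k = l := Fin.ext (by exact_mod_cast h2)
      rfl
    · rintro ⟨x, hx⟩
      obtain ⟨i, k, h⟩ := Q.exists_eq_zpow ⟨(x, 0), hx⟩
      obtain ⟨h1, h2⟩ := (hQ.snd_eq_zero_iff i k).1 (by rw [← h])
      lift k to ℕ using h1
      exact ⟨⟨i, k, by omega⟩, Subtype.ext (by
        change ((Q.step ^ (k : ℤ)) (Q.base i 0)).1.1 = x
        rw [← h])⟩
  rw [← Nat.card_coe_set_eq, ← Nat.card_congr (Equiv.ofBijective f hf), Nat.card_sigma]
  simp

variable [P.IsReduced] [P.IsIrreducible]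

theorem sub_eq_sub' (hQ : Q.IsNakayama κ m) (i j : b.support) :
    Q.ξ i - 2 * m i - Q.ξ (κ i) = Q.ξ j - 2 * m j - Q.ξ (κ j) := by
  refine b.induction_on_cartanMatrix
    (fun j => Q.ξ i - 2 * m i - Q.ξ (κ i) = Q.ξ j - 2 * m j - Q.ξ (κ j)) (i := i) rfl ?_
  intro j k hj hkj
  rcases eq_or_ne k j with rfl | hne
  · exact hj
  have h1 := lt_of_le_of_ne (b.cartanMatrix_le_zero_of_ne k j hne) hkj
  have h2 : Adj b k j := by
    change P.pairing k j < 0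
    rw [← P.algebraMap_pairingIn ℤ]
    simpa [Base.cartanMatrix, Base.cartanMatrixIn_def] using h1
  rw [hj, hQ.sub_eq_sub h2]

omit [Finite ι] [P.IsCrystallographic] [P.IsReduced] in
theorem _root_.DynkinRep.nonempty_support (b : P.Base) : Nonempty b.support := by
  have := IsIrreducible.nontrivial P
  by_contra h
  rw [not_nonempty_iff] at h
  obtain ⟨x, hx⟩ := exists_ne (0 : M)
  exact hx (ext_coeff b fun i => isEmptyElim i)

/-- Summing over all vertices cancels the heights, because `κ` is a permutation, and leaves `2 ∑ m_i
= |Δ₀| h`. -/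
theorem exists_card_mul_eq (hQ : Q.IsNakayama κ m) :
    ∃ h : ℕ, (∀ i, Q.ξ i - 2 * m i = Q.ξ (κ i) - h) ∧
      b.support.card * h = 2 * (posRoots b).ncard := by
  obtain ⟨i₀⟩ := nonempty_support b
  set h : ℤ := Q.ξ (κ i₀) - (Q.ξ i₀ - 2 * m i₀) with hh
  have h1 : ∀ i, Q.ξ i - 2 * m i = Q.ξ (κ i) - h := fun i => by
    have := hQ.sub_eq_sub' i i₀
    omega
  have h2 : (b.support.card : ℤ) * h = 2 * (posRoots b).ncard := by
    have h3 : ∑ i, Q.ξ (κ i) = ∑ i, Q.ξ i :=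
      hQ.involutive.bijective.sum_comp Q.ξ
    have h4 := Finset.sum_congr rfl fun i (_ : i ∈ Finset.univ) => h1 i
    rw [Finset.sum_sub_distrib, Finset.sum_sub_distrib, h3, ← Finset.mul_sum] at h4
    have h5 := hQ.sum_eq_ncard
    rw [← h5]
    push_cast
    simp only [Finset.sum_const, Finset.card_univ, Fintype.card_coe, nsmul_eq_mul] at h4
    linarith
  have h3 : 0 ≤ h := by
    have : 0 < (b.support.card : ℤ) := by
      exact_mod_cast Finset.card_pos.2 ⟨i₀.1, i₀.2⟩
    by_contra hneg
    have := mul_neg_of_pos_of_neg this (not_le.1 hneg)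
    have h5 : 0 ≤ 2 * ((posRoots b).ncard : ℤ) := by positivity
    omega
  lift h to ℕ using h3 with h'
  exact ⟨h', h1, by exact_mod_cast h2⟩

end IsNakayama

/-! ### The Coxeter number, the order of `τ_Q` and source reflections -/

variable [P.IsReduced] [P.IsIrreducible]

theorem card_mul_coxeterNumber (Q : DynkinQuiver b) :
    b.support.card * coxeterNumber b = 2 * (posRoots b).ncard := by
  obtain ⟨κ, m, hQ⟩ := Q.exists_isNakayama
  obtain ⟨h, -, h2⟩ := hQ.exists_card_mul_eq
  exact Nat.mul_div_cancel' ⟨h, h2.symm⟩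

theorem exists_isNakayama_star (Q : DynkinQuiver b) : ∃ m, Q.IsNakayama (star b) m ∧
    ∀ i, Q.ξ i - 2 * m i = Q.ξ (star b i) - coxeterNumber b := by
  obtain ⟨κ, m, hQ⟩ := Q.exists_isNakayama
  obtain ⟨h, h1, h2⟩ := hQ.exists_card_mul_eq
  have h3 : coxeterNumber b = h := by
    obtain ⟨i⟩ := nonempty_support b
    rw [coxeterNumber, ← h2, Nat.mul_div_cancel_left _ (Finset.card_pos.2 ⟨i.1, i.2⟩)]
  rw [← h3] at h1
  rw [← hQ.star_eq] at h1 hQ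
  exact ⟨m, hQ, h1⟩

theorem star_star (Q : DynkinQuiver b) (i : b.support) : star b (star b i) = i := by
  obtain ⟨m, hQ, -⟩ := Q.exists_isNakayama_star
  exact hQ.involutive i

theorem two_le_coxeterNumber (Q : DynkinQuiver b) : 2 ≤ coxeterNumber b := by
  obtain ⟨m, hQ, h⟩ := Q.exists_isNakayama_star
  obtain ⟨i⟩ := nonempty_support b
  have h1 := h i
  have h2 := h (star b i)
  rw [Q.star_star] at h2
  have h3 := hQ.pos i
  have h4 := hQ.pos (star b i)
  omega

/-- Two drops, `i` to `i*` and back to `i`, take `m_i + m_{i*} = h` steps. -/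
theorem zpow_coxeterNumber_base (Q : DynkinQuiver b) (i : b.support) (u : ℤ) :
    (Q.step ^ (coxeterNumber b : ℤ)) (Q.base i u) = Q.base i (u - 2) := by
  obtain ⟨m, hQ, h⟩ := Q.exists_isNakayama_star
  have h0 : ∀ i u, (Q.step ^ (m i : ℤ)) (Q.base i u) = Q.base (star b i) (u - 1) := by
    intro i u
    have h1 := ((Q.commute_step_shift u).zpow_left (m i)).eq
    have h2 := congr_arg (fun f => f (Q.base i 0)) h1
    simp only [Equiv.Perm.mul_apply, shift_base, hQ i, zero_add] at h2
    rw [h2, neg_add_eq_sub]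
  have h1 := h i
  have h2 := h (star b i)
  rw [Q.star_star] at h2
  rw [show (coxeterNumber b : ℤ) = m (star b i) + m i by omega, zpow_add, Equiv.Perm.mul_apply,
    h0, h0, Q.star_star, sub_sub]
  rfl

theorem orderOf_coxeterElement (Q : DynkinQuiver b) :
    orderOf Q.coxeterElement = coxeterNumber b := by
  have hpos : 0 < coxeterNumber b := by have := Q.two_le_coxeterNumber; omega
  have hpow : Q.coxeterElement ^ coxeterNumber b = 1 := by
    refine LinearEquiv.toLinearMap_injective (b.toWeightBasis.ext fun i => ?_)
    rw [← simpleRoot_eq]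
    obtain ⟨j, k, h⟩ := Q.exists_eq_zpow ⟨(simpleRoot b i, 0), simpleRoot_mem_posRoots b i⟩
    have h1 := Q.fst_zpow ⟨(simpleRoot b i, 0), simpleRoot_mem_posRoots b i⟩ (coxeterNumber b)
    have h2 : (Q.step ^ (coxeterNumber b : ℤ))
        ⟨(simpleRoot b i, 0), simpleRoot_mem_posRoots b i⟩ =
        ⟨(simpleRoot b i, -2), simpleRoot_mem_posRoots b i⟩ := by
      rw [h, ← Equiv.Perm.mul_apply, ← zpow_add, add_comm, zpow_add, Equiv.Perm.mul_apply,
        zpow_coxeterNumber_base, sub_eq_add_neg, ← Q.shift_base, ← Equiv.Perm.mul_apply,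
        ((Q.commute_step_shift _).zpow_left k).eq, Equiv.Perm.mul_apply, ← h]
      rfl
    rw [h2, zpow_natCast] at h1
    exact h1.trans (by rw [Int.negOnePow_even _ ⟨-1, by norm_num⟩, one_smul]; rfl)
  refine le_antisymm (orderOf_le_of_pow_eq_one hpos hpow) ?_
  obtain ⟨i⟩ := nonempty_support b
  set k := orderOf Q.coxeterElement with hk
  have hk0 : 0 < k := orderOf_pos_iff.2 Q.isOfFinOrder_coxeterElement
  have h1 := Q.fst_zpow (Q.base i 0) k
  set y := (Q.step ^ (k : ℤ)) (Q.base i 0) with hy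
  have h0 : y.1.2 ≤ 0 := (Q.le_iff_of_zpow_eq_base (x := Q.base i 0) (K := 0) rfl k).1 (by omega)
  rw [zpow_natCast, hk, pow_orderOf_eq_one] at h1
  change Q.γ i = (y.1.2 - 0).negOnePow • y.1.1 at h1
  rw [sub_zero] at h1
  -- For `k` the order, `τ^k γ_i = γ_i` forces an even level change; it is nonzero because an orbit
  -- never returns to the same point. The level is thus at most `-2`, first reached after `h` steps.
  have heven : Even y.1.2 := by
    by_contra hodd
    rw [Int.negOnePow_odd _ (Int.not_even_iff_odd.1 hodd), Units.smul_def, Units.val_neg,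
      Units.val_one, neg_smul, one_smul] at h1
    have h2 := Q.γ_mem_posRoots i
    rw [h1] at h2
    exact neg_notMem_posRoots b y.2 h2
  rw [Int.negOnePow_even _ heven, one_smul] at h1
  have hne : y.1.2 ≠ 0 := by
    intro h2
    have h3 : (Q.step ^ (k : ℤ)) (Q.base i 0) = Q.base i 0 :=
      Subtype.ext (Prod.ext h1.symm h2)
    have := (Q.eq_of_zpow_eq_base h3).1
    omega
  have h2 := (Q.le_iff_of_zpow_eq_base (Q.zpow_coxeterNumber_base i 0) k).2 (by
    rw [← hy]
    obtain ⟨r, hr⟩ := heven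
    omega)
  exact_mod_cast h2

theorem arVertices_eq (Q : DynkinQuiver b) :
    Q.arVertices = {x | x ∈ Q.repVertices ∧ x.2 ≤ Q.ξ x.1 ∧
      Q.ξ (star b x.1) - (coxeterNumber b : ℤ) < x.2} := by
  obtain ⟨m, hQ, h⟩ := Q.exists_isNakayama_star
  ext ⟨i, p⟩
  refine and_congr_right fun hx => ?_
  obtain ⟨r, hr⟩ : Even (p - Q.ξ i) := hx
  have h1 := h i
  have h2 : Q.φ (i, p) ∈ posRoots b ×ˢ ({0} : Set ℤ) ↔ (Q.φ (i, p)).2 = 0 := by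
    rw [φ, φAux_eq]
    exact and_iff_right ((Q.step ^ _) _).2
  rw [h2, φ, φAux_eq, hQ.snd_eq_zero_iff]
  dsimp only
  omega

omit [P.IsReduced] [P.IsIrreducible] in
theorem φ_eq_of_mem_arVertices (Q : DynkinQuiver b) {x : b.support × ℤ}
    (hx : x ∈ Q.arVertices) :
    Q.φ x = ((Q.coxeterElement ^ ((Q.ξ x.1 - x.2) / 2)) (Q.γ x.1), 0) := by
  have h : (Q.φ x).2 = 0 := hx.2.2
  have h1 := Q.fst_zpow (Q.base x.1 0) ((Q.ξ x.1 - x.2) / 2)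
  rw [← φAux_eq] at h1
  change _ = ((Q.φ x).2 - 0).negOnePow • (Q.φ x).1 at h1
  rw [h, sub_zero, Int.negOnePow_zero, one_smul] at h1
  exact Prod.ext h1.symm h

omit [P.IsReduced] [P.IsIrreducible] in
theorem φ_ξ (Q : DynkinQuiver b) (i : b.support) : Q.φ (i, Q.ξ i) = (Q.γ i, 0) := by
  rw [φ, φAux_eq]
  simp [base]

theorem even_sub_coxeterNumber (Q : DynkinQuiver b) (i : b.support) :
    Even (Q.ξ i - coxeterNumber b - Q.ξ (star b i)) := by
  obtain ⟨m, -, h⟩ := Q.exists_isNakayama_star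
  have h1 := h (star b i)
  rw [Q.star_star] at h1
  exact ⟨-m (star b i), by omega⟩

omit [P.IsRootSystem] [P.IsReduced] [P.IsIrreducible] in
theorem repVertices_reflect (Q : DynkinQuiver b) (i : b.support) (hi : Q.IsSource i) :
    (Q.reflect i hi).repVertices = Q.repVertices := by
  ext ⟨j, p⟩
  change Even (p - (Q.reflect i hi).ξ j) ↔ Even (p - Q.ξ j)
  rcases eq_or_ne j i with rfl | hj
  · rw [reflect_ξ_self, sub_sub_eq_add_sub, add_sub_right_comm, Int.even_add]
    simp
  · rw [reflect_ξ_of_ne _ _ hj]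

theorem φ_reflect_star (Q : DynkinQuiver b) (i : b.support) (hi : Q.IsSource i) :
    (Q.reflect i hi).φ (star b i, Q.ξ i - coxeterNumber b) = (simpleRoot b i, 0) := by
  set Q' := Q.reflect i hi with hQ'
  obtain ⟨m, hN, h⟩ := Q'.exists_isNakayama_star
  have h1 := h (star b i)
  rw [Q.star_star, reflect_ξ_self] at h1
  -- For `s_iQ`, column `i*` drops to level `-1` at height `ξ_i - 2 - h`, so this vertex is the one
  -- just before the drop.
  have h2 : (Q'.ξ (star b i) - (Q.ξ i - coxeterNumber b)) / 2 = -1 + (m (star b i) : ℤ) := by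
    omega
  rw [φ, φAux_eq]
  dsimp only
  rw [h2, zpow_add, Equiv.Perm.mul_apply, hN, Q.star_star, zpow_neg_one]
  have h3 : Q'.γ i = simpleReflection b i (Q.coxeterElement (simpleRoot b i)) := by
    rw [γ, hQ', coxeterElement_reflect, LinearEquiv.mul_apply, LinearEquiv.mul_apply,
      simpleReflection_fundamentalWeight, map_sub, coxeterElement_fundamentalWeight hi,
      simpleReflection_fundamentalWeight, map_sub, map_sub, simpleReflection_fundamentalWeight,
      simpleReflection_simpleRoot]
    abel
  have h4 : Q'.coxeterElement⁻¹ (Q'.γ i) = -simpleRoot b i := by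
    have h5 : Q'.coxeterElement (-simpleRoot b i) = Q'.γ i := by
      rw [h3, hQ', coxeterElement_reflect, LinearEquiv.mul_apply, LinearEquiv.mul_apply, map_neg,
        simpleReflection_simpleRoot, neg_neg]
    rw [← h5]
    exact Q'.coxeterElement.symm_apply_apply _
  change signedStep b Q'.coxeterElement⁻¹ 1 (Q'.γ i, -1) = _
  rw [signedStep]
  dsimp only
  rw [h4, if_neg (neg_notMem_posRoots b (simpleRoot_mem_posRoots b i)), neg_neg]
  rfl

theorem arVertices_reflect (Q : DynkinQuiver b) (i : b.support) (hi : Q.IsSource i) :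
    (Q.reflect i hi).arVertices =
      (Q.arVertices \ {(i, Q.ξ i)}) ∪ {(star b i, Q.ξ i - (coxeterNumber b : ℤ))} := by
  obtain ⟨m, hN, h⟩ := Q.exists_isNakayama_star
  have hlt : ∀ j, Q.ξ j - coxeterNumber b + 2 ≤ Q.ξ (star b j) := by
    intro j
    have h1 := h (star b j)
    have h2 := hN.pos (star b j)
    rw [Q.star_star] at h1
    omega
  have h2 := Q.two_le_coxeterNumber
  rw [arVertices_eq, arVertices_eq, repVertices_reflect]
  ext ⟨j, p⟩
  have hev : Even (Q.ξ i - coxeterNumber b - Q.ξ (star b i)) := Q.even_sub_coxeterNumber i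
  have hevj := Q.even_sub_coxeterNumber j
  have hj := hlt j
  have hi := hlt i
  have hjs : star b j = i ↔ j = star b i :=
    ⟨fun e => by rw [← e, Q.star_star], fun e => by rw [e, Q.star_star]⟩
  have hrep : (j, p) ∈ Q.repVertices ↔ Even (p - Q.ξ j) := Iff.rfl
  simp only [Set.mem_ofPred_eq, Set.mem_union, Set.mem_sdiff, Set.mem_singleton_iff, Prod.mk.injEq,
    hrep, reflect, ← hjs]
  rw [Int.even_iff] at hev hevj ⊢
  -- Column `i` loses its top vertex and column `i*` gains one at the bottom. When `i = i*` both
  -- happen in one column, and `h ≥ 2` keeps the new vertex below the lowered top.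
  by_cases h3 : j = i <;> by_cases h4 : star b j = i
  · subst h3
    simp only [h4, if_true, true_and] at *
    omega
  · subst h3
    simp only [h4, if_true, if_false, true_and, false_and, or_false] at *
    omega
  · rw [← hjs.1 h4] at hi hev
    simp only [h3, h4, if_true, if_false, true_and, false_and, not_false_eq_true, and_true] at *
    omega
  · simp only [h3, h4, if_false, false_and, or_false, not_false_eq_true, and_true, sub_zero]

end DynkinQuiver

end Nakayama

end DynkinRep

theorem mainTheorem3 {ι M N : Type*} [Finite ι] [AddCommGroup M] [Module ℚ M]
    [AddCommGroup N] [Module ℚ N] (P : RootPairing ι ℚ M N) [P.IsRootSystem] [P.IsCrystallographic]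
    [P.IsReduced] [P.IsIrreducible] (b : P.Base) (Q : DynkinRep.DynkinQuiver b) :
    (b.support.card * DynkinRep.coxeterNumber b = 2 * (DynkinRep.posRoots b).ncard ∧
      orderOf Q.coxeterElement = DynkinRep.coxeterNumber b) ∧
    Set.BijOn Q.φ Q.repVertices (DynkinRep.posRoots b ×ˢ (Set.univ : Set ℤ)) ∧
    Q.arVertices = {x | x ∈ Q.repVertices ∧ x.2 ≤ Q.ξ x.1 ∧
      Q.ξ (DynkinRep.star b x.1) - (DynkinRep.coxeterNumber b : ℤ) < x.2} ∧
    (∀ x ∈ Q.arVertices, Q.φ x = ((Q.coxeterElement ^ ((Q.ξ x.1 - x.2) / 2)) (Q.γ x.1), 0)) ∧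
    ∀ (i : b.support) (hi : Q.IsSource i),
      (DynkinRep.star b i, Q.ξ i - (DynkinRep.coxeterNumber b : ℤ)) ∈
        (Q.reflect i hi).repVertices ∧
      (Q.reflect i hi).φ (DynkinRep.star b i, Q.ξ i - (DynkinRep.coxeterNumber b : ℤ)) =
        Q.φ (i, Q.ξ i) ∧
      Q.φ (i, Q.ξ i) = (DynkinRep.simpleRoot b i, 0) ∧
      (Q.reflect i hi).arVertices =
        (Q.arVertices \ {(i, Q.ξ i)}) ∪
          {(DynkinRep.star b i, Q.ξ i - (DynkinRep.coxeterNumber b : ℤ))} := by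

  refine ⟨⟨Q.card_mul_coxeterNumber, Q.orderOf_coxeterElement⟩, Q.bijOn_φ, Q.arVertices_eq,
    fun x hx => Q.φ_eq_of_mem_arVertices hx, fun i hi => ?_⟩
  have h : Q.φ (i, Q.ξ i) = (DynkinRep.simpleRoot b i, 0) := by
    rw [Q.φ_ξ, DynkinRep.DynkinQuiver.γ_eq_simpleRoot hi]
  refine ⟨?_, (Q.φ_reflect_star i hi).trans h.symm, h, Q.arVertices_reflect i hi⟩
  rw [Q.repVertices_reflect]
  exact Q.even_sub_coxeterNumber i
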